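/- Let $d, D$ be natural numbers. For a closed set $A\subset\mathbb{R}^D$, write $\mathrm{Proj}_A(x)$ for the nearest point of $A$ to $x$ (when unique); the reach of $A$ is the supremum of all $t$ such that every $x$ with $\mathrm{dist}(x,A)\le t$ has a unique nearest point in $A$. For linear subspaces $U,W\subset\mathbb{R}^D$ of the same dimension $m$, the principal vectors $(u_i,w_i)$, $1\le i\le m$, are chosen recursively: $(u_i,w_i)\in U\times W$ minimizes $\arccos|\langle u,w\rangle|$ over all unit vectors $u\in U$, $w\in W$ with $u\perp u_j$ and $w\perp w_j$ for all $j<i$; the principal angles are $\beta_i=\arccos|\langle u_i,w_i\rangle|$, and $\angle_{\max}(U,W)=\max_i\beta_i$ (read as $0$ if $m=0$). Theorem. There are constants $C_M>0$ and $M_0>0$, depending only on $d$ and $D$, with the following property. Let $k\ge 1$, let $\mathcal{M}\subset\mathbb{R}^D$ be a compact $d$-dimensional $C^k$ submanifold without boundary with finite reach $\tau$, let $\sigma>0$, and assume that $M=\tau/\sigma\ge M_0$. Let $\mathcal{M}_\sigma=\{x\in\mathbb{R}^D:\mathrm{dist}(x,\mathcal{M})<\sigma\}$ and $r\in\mathcal{M}_\sigma$.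 Given points $r_1,\dots,r_n$, let $U_{\mathrm{ROI}}=\{r_i:\|r_i-r\|<\sqrt{\sigma\tau}\}$, let $N$ be the number of samples in $U_{\mathrm{ROI}}$, and for $q\in\mathbb{R}^D$ and a $d$-dimensional linear subspace $H$ put $$J_1(r;q,H)=\frac1N\sum_{r_i\in U_{\mathrm{ROI}}}\mathrm{dist}^2(r_i-q,H)$$ (read as $0$ if $N=0$). Let $(q^*,H^*)$ denote any minimizer of $J_1(r;q,H)$ over all pairs $(q,H)$ with $\dim H=d$, $r-q\perp H$ and $\|r-q\|<2\sigma$, and let $p=\mathrm{Proj}_{\mathcal{M}}(q^*)$. Then: 1. For every $\delta>0$ there is $N_\delta$ such that for all $n>N_\delta$, if $r_1,\dots,r_n$ are drawn independently from the uniform distribution (normalized Lebesgue measure) on $\mathcal{M}_\sigma$, then with probability at least $1-\delta$ every such minimizer satisfies $$\angle_{\max}(H^*,T_p\mathcal{M})\le\sqrt{C_M/M}.$$ 2. For every $n$ and all points $r_1,\dots,r_n$, every such minimizer satisfies $\|p-q^*\|\le 3\sigma$. -/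

import Mathlib

open MeasureTheory

/-- `ℝ^D` with its Euclidean norm. -/
abbrev RD (D : ℕ) : Type := EuclideanSpace ℝ (Fin D)

/-- `p` is a point of `A` nearest to `x`. When it is unique, `p = Proj_A(x)`. -/
def IsNearestPoint {D : ℕ} (A : Set (RD D)) (x p : RD D) : Prop :=
  p ∈ A ∧ ∀ a ∈ A, dist x p ≤ dist x a

/-- The reach of `A`: the supremum (possibly `∞`) of all `t` such that every point at distance at
most `t` from `A` has a unique nearest point in `A`. -/
noncomputable def reach {D : ℕ} (A : Set (RD D)) : ENNReal :=
  sSup {t : ENNReal | ∀ x : RD D, Metric.infEDist x A ≤ t → ∃! p : RD D, IsNearestPoint A x p}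

/-- `A` is a (boundaryless, embedded) `d`-dimensional `C^k` submanifold of `ℝ^D`: every point has an
open neighbourhood `U` such that `A ∩ U` is parametrized by an open subset `V` of `ℝ^d` through a
`C^k` immersion `f` which is a homeomorphism onto its image. -/
def IsSubmanifold {D : ℕ} (k d : ℕ) (A : Set (RD D)) : Prop :=
  ∀ p ∈ A, ∃ (U : Set (RD D)) (V : Set (RD d)) (f : RD d → RD D),
    IsOpen U ∧ p ∈ U ∧ IsOpen V ∧
    ContDiffOn ℝ k f V ∧ (∀ v ∈ V, Function.Injective (fderiv ℝ f v)) ∧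
    Topology.IsEmbedding (V.domRestrict f) ∧ f '' V = A ∩ U

/-- The tangent space of `A` at `p`, as a linear subspace of `ℝ^D`: the span of the velocities at
`p` of the curves in `A` through `p`. (For a submanifold, these velocities already form a linear
subspace.) -/
noncomputable def tangentSpaceAt {D : ℕ} (A : Set (RD D)) (p : RD D) : Submodule ℝ (RD D) :=
  Submodule.span ℝ {v : RD D | ∃ γ : ℝ → RD D,
    γ 0 = p ∧ (∀ᶠ t in nhds (0 : ℝ), γ t ∈ A) ∧ HasDerivAt γ v 0}

/-- The pairs `(u, w)` admissible at step `i` of the definition of principal vectors: unit vectors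
of `U` and `W`, orthogonal to the vectors `us j` resp. `ws j` chosen at the previous steps. -/
def IsAdmissiblePair {D m : ℕ} (U W : Submodule ℝ (RD D)) (us ws : Fin m → RD D) (i : Fin m)
    (u w : RD D) : Prop :=
  u ∈ U ∧ w ∈ W ∧ ‖u‖ = 1 ∧ ‖w‖ = 1 ∧
    ∀ j < i, inner ℝ (us j) u = 0 ∧ inner ℝ (ws j) w = 0

/-- `us`, `ws` are sequences of principal vectors of `U` and `W`: each pair `(us i, ws i)` minimizes
`arccos |⟨u, w⟩|` among the pairs admissible at step `i`. -/
def IsPrincipalVectors {D m : ℕ} (U W : Submodule ℝ (RD D)) (us ws : Fin m → RD D) : Prop :=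
  ∀ i : Fin m, IsAdmissiblePair U W us ws i (us i) (ws i) ∧
    ∀ u w : RD D, IsAdmissiblePair U W us ws i u w →
      Real.arccos |inner ℝ (us i) (ws i)| ≤ Real.arccos |inner ℝ u w|

/-- The maximal principal angle between `U` and `W` (with `dim U ≤ dim W`): the largest of the
principal angles `arccos |⟨us i, ws i⟩|`, `i = 1, …, dim U`. (They do not depend on the choice of the
principal vectors. If `dim U = 0` there are none and the value is `0`.) -/
noncomputable def maxPrincipalAngle {D : ℕ} (U W : Submodule ℝ (RD D)) : ℝ :=
  sSup {β : ℝ | ∃ us ws : Fin (Module.finrank ℝ U) → RD D, IsPrincipalVectors U W us ws ∧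
    ∃ i, β = Real.arccos |inner ℝ (us i) (ws i)|}

/-- The uniform distribution on the tube `A_σ = {x | dist(x, A) < σ}`: normalized Lebesgue
measure. -/
noncomputable def tubeUniform {D : ℕ} (A : Set (RD D)) (σ : ℝ) : Measure (RD D) :=
  ProbabilityTheory.cond volume (Metric.thickening σ A)

/-- The (indices of the) samples in the region of interest, the open ball of radius `ρ` about
`r`. -/
noncomputable def roi {D n : ℕ} (ρ : ℝ) (r : RD D) (x : Fin n → RD D) : Finset (Fin n) :=
  Finset.univ.filter fun i => dist (x i) r < ρ

/-- The functional `J₁(r; q, H)`: the mean over the samples `x i` in the region of interest of the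
squared distance from `x i - q` to `H`. -/
noncomputable def J1 {D n : ℕ} (ρ : ℝ) (r : RD D) (x : Fin n → RD D)
    (q : RD D) (H : Submodule ℝ (RD D)) : ℝ :=
  (1 / ((roi ρ r x).card : ℝ)) *
    ∑ i ∈ roi ρ r x, Metric.infDist (x i - q) (H : Set (RD D)) ^ 2

/-- The search space: `H` is a `d`-dimensional linear subspace, `r - q ⊥ H` and `‖r - q‖ < 2σ`. -/
def IsFeasible {D : ℕ} (d : ℕ) (σ : ℝ) (r q : RD D) (H : Submodule ℝ (RD D)) : Prop :=
  Module.finrank ℝ H = d ∧ r - q ∈ Hᗮ ∧ ‖r - q‖ < 2 * σ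

/-- `(q, H)` is an output for the samples `x` and the input point `r`: a minimizer of `J₁`, with
region of interest of radius `√(στ)`, over the search space. -/
def IsStep1Output {D n : ℕ} (d : ℕ) (σ τ : ℝ) (r : RD D) (x : Fin n → RD D)
    (q : RD D) (H : Submodule ℝ (RD D)) : Prop :=
  IsFeasible d σ r q H ∧
    ∀ (q' : RD D) (H' : Submodule ℝ (RD D)), IsFeasible d σ r q' H' →
      J1 (√(σ * τ)) r x q H ≤ J1 (√(σ * τ)) r x q' H'

/-!
Write `M = τ / σ` and `ρ = √(σ τ) = σ √M = τ / √M` for the radius of the region of interest,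
let `p₀` be the point of `S` nearest to `r`, and `T` its tangent space. The theorem is a
comparison of scales: inside the region of interest the tube is a slab of thickness `O(σ)`
around `p₀ + T`, whose extent in the directions of `T` is of order `ρ`.

* Since `S` leaves `p₀ + T` by at most `‖b - p₀‖² / (2 τ)`
  (`norm_sub_starProjection_tangentSpaceAt_le`), all samples in the region of interest are
  within `3 σ` of `p₀ + T`. As `(p₀, T)` is feasible, a minimizer `(q, H)` has mean squared
  residual at most `9 σ²`.
* For each vector `e` of an orthonormal basis of `T`, and for `e = 0`, a ball of radius
  comparable to `ρ` about `p₀ + (ρ / 2) e` captures a fixed proportion of the volume of the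
  tube in the region of interest (`ofReal_mul_volume_roi_le`), hence with high probability a
  fixed proportion of the samples there (`exists_forall_exists_measurableSet_pi`). By Markov's
  inequality each of these balls contains a sample with residual `O(σ)`. So `H` comes within
  `O(σ)` of points spread over a distance `ρ` in all directions of `T`, and `T` is within `O(σ
  / ρ) = O(1 / √M)` of `H` (`norm_sub_starProjection_le_of_samples`). As the dimensions agree,
  `H` is as close to `T`.
* The point `p` nearest to `q` is within `6 σ` of `p₀`, so its tangent space differs from `T`
  by `O(σ / τ)` only. Finally, closeness of unit vectors of `H` to the tangent space bounds
  every principal angle (`maxPrincipalAngle_le_of_near`).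

The bound `‖p - q‖ ≤ 3 σ` is the triangle inequality.

The geometry of sets of positive reach is developed from the definition. Distances to `S`
inside the reach attain the largest conceivable growth (`exists_infDist_ge`), so nearest points
stay nearest along normal rays up to the reach; this gives Federer's quadratic estimate for a
`C¹` submanifold. That `S` projects onto a ball of its tangent space, which is where the
absence of a boundary enters, and that tangent spaces vary in a Lipschitz way, are proved
together: a first point at which a tangent space has turned by a right angle is excluded by the
graph property up to half the distance to it
(`eq_zero_of_mem_tangentSpaceAt_of_mem_orthogonal`).
-/

/-! ### Principal angles and projections -/

theorem inner_eq_zero_of_forall_sq_le {p s : ℝ}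
    (h : ∀ t : ℝ, (p + t * s) ^ 2 ≤ (1 + t ^ 2) * p ^ 2) : s = 0 := by
  by_contra hs
  have hs2 : 0 < s ^ 2 := by positivity
  by_cases hp : p = 0
  · have := h 1
    rw [hp] at this
    nlinarith
  · have hp2 : 0 < p ^ 2 := by positivity
    have h1 := h (s / p)
    have e1 : (p + s / p * s) ^ 2 = p ^ 2 + 2 * s ^ 2 + (s / p) ^ 2 * s ^ 2 := by
      field_simp; ring
    have e2 : (1 + (s / p) ^ 2) * p ^ 2 = p ^ 2 + s ^ 2 := by
      field_simp
    rw [e1, e2] at h1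
    nlinarith [mul_nonneg (sq_nonneg (s / p)) (sq_nonneg s)]

theorem abs_inner_le_of_arccos_le {D : ℕ} {a b u v : RD D} (ha : ‖a‖ = 1) (hb : ‖b‖ = 1)
    (hu : ‖u‖ = 1) (hv : ‖v‖ = 1)
    (h : Real.arccos |inner ℝ a b| ≤ Real.arccos |inner ℝ u v|) :
    |inner ℝ u v| ≤ |inner ℝ a b| := by
  have h1 := abs_real_inner_le_norm a b
  have h2 := abs_real_inner_le_norm u v
  rw [ha, hb, one_mul] at h1
  rw [hu, hv, one_mul] at h2
  refine (Real.strictAntiOn_arccos.le_iff_ge ?_ ?_).1 h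
  · exact ⟨by linarith [abs_nonneg (inner ℝ a b)], h1⟩
  · exact ⟨by linarith [abs_nonneg (inner ℝ u v)], h2⟩

/-- By optimality of the earlier pairs, each `us i` is orthogonal to every earlier `ws j`. -/
theorem IsPrincipalVectors.inner_eq_zero {D m : ℕ} {U W : Submodule ℝ (RD D)}
    {us ws : Fin m → RD D} (h : IsPrincipalVectors U W us ws) {i j : Fin m} (hij : j < i) :
    inner ℝ (ws j) (us i) = 0 := by
  obtain ⟨hiU, -, hi1, -, hio⟩ := (h i).1
  obtain ⟨⟨hjU, hjW, hj1, hjw1, hjo⟩, hopt⟩ := h j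
  have horth : inner ℝ (us j) (us i) = 0 := (hio j hij).1
  apply inner_eq_zero_of_forall_sq_le (p := inner ℝ (ws j) (us j))
  intro t
  -- compare with the competitor obtained by rotating `us j` towards `us i`
  set v : RD D := us j + t • us i with hv
  have hvn : ‖v‖ ^ 2 = 1 + t ^ 2 := by
    rw [hv, norm_add_sq_real, norm_smul, inner_smul_right, horth, hj1, hi1]
    simp
  have hvpos : 0 < ‖v‖ := by
    have : 0 < ‖v‖ ^ 2 := by rw [hvn]; positivity
    exact (norm_nonneg v).lt_of_ne' (sq_pos_iff.1 this)
  have hun : ‖(‖v‖⁻¹ : ℝ) • v‖ = 1 := by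
    rw [norm_smul, norm_inv, norm_norm, inv_mul_cancel₀ hvpos.ne']
  have hadm : IsAdmissiblePair U W us ws j ((‖v‖⁻¹ : ℝ) • v) (ws j) := by
    refine ⟨U.smul_mem _ (U.add_mem hjU (U.smul_mem _ hiU)), hjW, hun, hjw1, ?_⟩
    intro l hl
    refine ⟨?_, (hjo l hl).2⟩
    rw [inner_smul_right, hv, inner_add_right, inner_smul_right, (hjo l hl).1,
      (hio l (hl.trans hij)).1]
    simp
  have h1 := abs_inner_le_of_arccos_le hj1 hjw1 hun hjw1 (hopt _ _ hadm)
  have h2 := mul_self_le_mul_self (abs_nonneg _) h1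
  rw [abs_mul_abs_self, abs_mul_abs_self, real_inner_smul_left] at h2
  have e : inner ℝ v (ws j) = inner ℝ (ws j) (us j) + t * inner ℝ (ws j) (us i) := by
    rw [real_inner_comm, hv, inner_add_right, inner_smul_right]
  rw [e, real_inner_comm (ws j) (us j)] at h2
  rw [← hvn]
  have : (inner ℝ (ws j) (us j) + t * inner ℝ (ws j) (us i)) ^ 2
      = ‖v‖ ^ 2 * (‖v‖⁻¹ * (inner ℝ (ws j) (us j) + t * inner ℝ (ws j) (us i))
        * (‖v‖⁻¹ * (inner ℝ (ws j) (us j) + t * inner ℝ (ws j) (us i)))) := by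
    field_simp
  rw [this]
  gcongr
  linarith

theorem inner_starProjection_of_mem {D : ℕ} {W : Submodule ℝ (RD D)} {w : RD D} (hw : w ∈ W)
    (u : RD D) : inner ℝ w (W.starProjection u) = inner ℝ w u := by
  rw [← W.inner_starProjection_left_eq_right, W.starProjection_eq_self_iff.2 hw]

/-- The maximal principal angle is at most `θ` as soon as every unit vector of `U` keeps at least the
proportion `cos θ` of its length when projected to `W`: the normalized projection of `us i` is
admissible at step `i`. -/
theorem maxPrincipalAngle_le {D : ℕ} {U W : Submodule ℝ (RD D)} {θ : ℝ} (hθ : 0 ≤ θ)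
    (h : θ < Real.pi / 2 → ∀ u ∈ U, ‖u‖ = 1 → Real.cos θ ≤ ‖W.starProjection u‖) :
    maxPrincipalAngle U W ≤ θ := by
  apply Real.sSup_le _ hθ
  rintro β ⟨us, ws, hP, i, rfl⟩
  rcases le_or_gt (Real.pi / 2) θ with hpi | hpi
  · exact (Real.arccos_le_pi_div_two.2 (abs_nonneg _)).trans hpi
  obtain ⟨⟨hiU, hiW, hi1, hiw1, hio⟩, hopt⟩ := hP i
  have hcos := h hpi _ hiU hi1
  have hcpos : 0 < Real.cos θ := Real.cos_pos_of_mem_Ioo ⟨by linarith [Real.pi_pos], hpi⟩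
  set w := W.starProjection (us i) with hw
  have hwpos : 0 < ‖w‖ := hcpos.trans_le hcos
  have hwW : w ∈ W := W.starProjection_apply_mem _
  have hadm : IsAdmissiblePair U W us ws i (us i) ((‖w‖⁻¹ : ℝ) • w) := by
    refine ⟨hiU, W.smul_mem _ hwW, hi1, ?_, fun j hj => ⟨(hio j hj).1, ?_⟩⟩
    · rw [norm_smul, norm_inv, norm_norm, inv_mul_cancel₀ hwpos.ne']
    · rw [inner_smul_right, hw, inner_starProjection_of_mem (hP j).1.2.1,
        hP.inner_eq_zero hj, mul_zero]
  refine (hopt _ _ hadm).trans ?_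
  have e : inner ℝ (us i) ((‖w‖⁻¹ : ℝ) • w) = ‖w‖ := by
    rw [inner_smul_right, real_inner_comm, ← inner_starProjection_of_mem hwW, ← hw,
      real_inner_self_eq_norm_sq]
    field_simp
  rw [e, abs_of_pos hwpos]
  calc Real.arccos ‖w‖ ≤ Real.arccos (Real.cos θ) := Real.arccos_le_arccos hcos
    _ = θ := Real.arccos_cos hθ (by linarith [Real.pi_pos])

theorem norm_sub_starProjection_le {D : ℕ} (K : Submodule ℝ (RD D)) (x : RD D) {y : RD D}
    (hy : y ∈ K) : ‖x - K.starProjection x‖ ≤ ‖x - y‖ := by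
  rw [K.starProjection_minimal x]
  exact ciInf_le ⟨0, by rintro _ ⟨z, rfl⟩; positivity⟩ (⟨y, hy⟩ : K)

theorem norm_sub_starProjection_le_norm {D : ℕ} (K : Submodule ℝ (RD D)) (x : RD D) :
    ‖x - K.starProjection x‖ ≤ ‖x‖ := by
  simpa using norm_sub_starProjection_le K x K.zero_mem

theorem infDist_eq_norm_sub_starProjection {D : ℕ} (K : Submodule ℝ (RD D)) (x : RD D) :
    Metric.infDist x (K : Set (RD D)) = ‖x - K.starProjection x‖ := by
  apply le_antisymm
  · rw [← dist_eq_norm]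
    exact Metric.infDist_le_dist_of_mem (K.starProjection_apply_mem x)
  · refine (Metric.le_infDist ⟨0, K.zero_mem⟩).2 fun y hy => ?_
    rw [dist_eq_norm]
    exact norm_sub_starProjection_le K x hy

theorem norm_sq_eq_starProjection_add {D : ℕ} (K : Submodule ℝ (RD D)) (x : RD D) :
    ‖x‖ ^ 2 = ‖K.starProjection x‖ ^ 2 + ‖x - K.starProjection x‖ ^ 2 := by
  have h := Submodule.norm_sq_eq_add_norm_sq_starProjection x K
  rwa [K.starProjection_orthogonal_val] at h

/-- If every vector of `W` is close to `U` and the dimensions agree, then projecting `W` to `U` is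
onto, so every vector of `U` is close to one of `W`. -/
theorem exists_mem_near_of_forall_near {D : ℕ} {U W : Submodule ℝ (RD D)} {s : ℝ}
    (hs : s ≤ 1 / 2) (hdim : Module.finrank ℝ U = Module.finrank ℝ W)
    (h : ∀ w ∈ W, ‖w - U.starProjection w‖ ≤ s * ‖w‖) {u : RD D} (hu : u ∈ U) :
    ∃ w ∈ W, ‖w‖ ≤ 2 * ‖u‖ ∧ ‖u - w‖ ≤ s * ‖w‖ := by
  let L : W →ₗ[ℝ] U := (U.orthogonalProjectionOnto : RD D →ₗ[ℝ] U) ∘ₗ W.subtype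
  have hL : ∀ w : W, ((L w : U) : RD D) = U.starProjection (w : RD D) := fun w => rfl
  have hinj : Function.Injective L := by
    rw [← LinearMap.ker_eq_bot, LinearMap.ker_eq_bot']
    intro w hw
    have h1 := h w w.2
    rw [← hL, hw] at h1
    simp only [ZeroMemClass.coe_zero, sub_zero] at h1
    have : ‖(w : RD D)‖ = 0 := by nlinarith [norm_nonneg (w : RD D)]
    simpa using this
  obtain ⟨w, hw⟩ := (LinearMap.injective_iff_surjective_of_finrank_eq_finrank hdim.symm).1 hinj
    ⟨u, hu⟩
  have hwu : U.starProjection (w : RD D) = u := by rw [← hL, hw]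
  have h1 := h w w.2
  rw [hwu] at h1
  refine ⟨w, w.2, ?_, by rwa [norm_sub_rev]⟩
  have h2 : ‖(w : RD D)‖ ≤ ‖(w : RD D) - u‖ + ‖u‖ := by
    simpa using norm_add_le ((w : RD D) - u) u
  nlinarith [norm_nonneg (w : RD D)]

/-- If unit vectors of `U` are within `ε` of `W`, the maximal principal angle is at most `π ε / 2`. -/
theorem maxPrincipalAngle_le_of_near {D : ℕ} {U W : Submodule ℝ (RD D)} {ε θ : ℝ} (hε : 0 ≤ ε)
    (hθ : Real.pi / 2 * ε ≤ θ) (h : ∀ u ∈ U, ‖u - W.starProjection u‖ ≤ ε * ‖u‖) :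
    maxPrincipalAngle U W ≤ θ := by
  have hθ0 : 0 ≤ θ := le_trans (by positivity) hθ
  apply maxPrincipalAngle_le hθ0
  intro hpi u hu hu1
  have h1 := h u hu
  have h2 := norm_sq_eq_starProjection_add W u
  rw [hu1] at h1 h2
  have h3 : ε ≤ Real.sin θ := by
    have := Real.mul_le_sin hθ0 hpi.le
    refine le_trans ?_ this
    calc ε = 2 / Real.pi * (Real.pi / 2 * ε) := by field_simp
      _ ≤ _ := by gcongr
  have h4 := Real.sin_sq_add_cos_sq θ
  apply le_of_sq_le_sq _ (norm_nonneg _)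
  nlinarith [norm_nonneg (u - W.starProjection u)]

/-! ### Nearest points and the reach -/

theorem IsNearestPoint.infDist_eq {D : ℕ} {S : Set (RD D)} {x p : RD D}
    (h : IsNearestPoint S x p) : Metric.infDist x S = dist x p :=
  le_antisymm (Metric.infDist_le_dist_of_mem h.1)
    ((Metric.le_infDist ⟨p, h.1⟩).2 fun a ha => h.2 a ha)

theorem exists_isNearestPoint {D : ℕ} {S : Set (RD D)} (hS : IsCompact S) (hne : S.Nonempty)
    (x : RD D) : ∃ p, IsNearestPoint S x p := by
  obtain ⟨p, hp, h⟩ := hS.exists_isMinOn hne (f := fun a => dist x a) (by fun_prop)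
  exact ⟨p, hp, fun a ha => h ha⟩

theorem existsUnique_isNearestPoint_of_lt_reach {D : ℕ} {S : Set (RD D)} {τ : ℝ}
    (hne : S.Nonempty) (hr : reach S = ENNReal.ofReal τ) {x : RD D}
    (hx : Metric.infDist x S < τ) : ∃! p, IsNearestPoint S x p := by
  have h1 : Metric.infEDist x S < reach S := by
    rw [hr]
    exact (ENNReal.lt_ofReal_iff_toReal_lt (Metric.infEDist_ne_top hne)).2 hx
  obtain ⟨t, ht, hlt⟩ := lt_sSup_iff.1 h1
  exact ht x hlt.le

/-- The nearest point depends continuously on the point, wherever it is unique. -/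
theorem nearestPoint_near {D : ℕ} {S : Set (RD D)} (hS : IsCompact S) {y a : RD D}
    (ha : IsNearestPoint S y a) (huniq : ∀ b, IsNearestPoint S y b → b = a) {ε : ℝ} (hε : 0 < ε) :
    ∃ η > 0, ∀ y', dist y' y < η → ∀ b, IsNearestPoint S y' b → dist b a < ε := by
  by_cases hne : (S \ Metric.ball a ε).Nonempty
  · have hK : IsCompact (S \ Metric.ball a ε) := hS.diff Metric.isOpen_ball
    obtain ⟨b₀, hb₀, hmin⟩ := hK.exists_isMinOn hne (f := fun b => dist y b) (by fun_prop)
    have hgap : dist y a < dist y b₀ := by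
      by_contra! hcon
      have : b₀ = a := huniq b₀ ⟨hb₀.1, fun c hc => hcon.trans (ha.2 c hc)⟩
      exact hb₀.2 (by rw [this]; exact Metric.mem_ball_self hε)
    refine ⟨(dist y b₀ - dist y a) / 2, by linarith, fun y' hy' b hb => ?_⟩
    by_contra! hcon
    have hbK : b ∈ S \ Metric.ball a ε := ⟨hb.1, by simpa using hcon⟩
    have h1 : dist y b₀ ≤ dist y b := hmin hbK
    have h2 := hb.2 a ha.1
    have h3 := dist_triangle y' y a
    have h4 := dist_triangle_left y b y'
    linarith
  · refine ⟨1, one_pos, fun y' _ b hb => ?_⟩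
    by_contra! hcon
    exact hne ⟨b, hb.1, by simpa using hcon⟩

/-- Where the nearest point is unique, the distance function grows with slope `1` in the direction
away from it. -/
theorem infDist_slope {D : ℕ} {S : Set (RD D)} (hS : IsCompact S) {y a : RD D}
    (ha : IsNearestPoint S y a) (huniq : ∀ b, IsNearestPoint S y b → b = a)
    (hpos : 0 < ‖y - a‖) {c : ℝ} (hc1 : c < 1) :
    ∃ s₀ > 0, ∀ s, 0 < s → s < s₀ →
      Metric.infDist y S + c * s ≤ Metric.infDist (y + s • (‖y - a‖⁻¹ • (y - a))) S := by
  set n : RD D := ‖y - a‖⁻¹ • (y - a) with hn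
  have hn1 : ‖n‖ = 1 := by rw [hn, norm_smul, norm_inv, norm_norm, inv_mul_cancel₀ hpos.ne']
  have hopen : IsOpen {b : RD D | c * ‖y - b‖ < inner ℝ n (y - b)} :=
    isOpen_lt (by fun_prop) (by fun_prop)
  have hmem : a ∈ {b : RD D | c * ‖y - b‖ < inner ℝ n (y - b)} := by
    have : inner ℝ n (y - a) = ‖y - a‖ := by
      rw [hn, real_inner_smul_left, real_inner_self_eq_norm_sq]; field_simp
    simp only [Set.mem_ofPred_eq, this]
    nlinarith
  obtain ⟨ε, hε, hball⟩ := Metric.isOpen_iff.1 hopen a hmem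
  obtain ⟨η, hη, hnear⟩ := nearestPoint_near hS ha huniq hε
  refine ⟨η, hη, fun s hs hsη => ?_⟩
  obtain ⟨b, hb⟩ := exists_isNearestPoint hS ⟨a, ha.1⟩ (y + s • n)
  have hba : dist b a < ε := by
    refine hnear _ ?_ b hb
    rw [dist_eq_norm, add_sub_cancel_left, norm_smul, hn1, mul_one, Real.norm_of_nonneg hs.le]
    exact hsη
  have h1 : c * ‖y - b‖ < inner ℝ n (y - b) := hball hba
  have h2 : ‖y - a‖ ≤ ‖y - b‖ := by simpa [dist_eq_norm] using ha.2 b hb.1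
  have h3 := real_inner_le_norm (y + s • n - b) (y - b)
  have e : inner ℝ (y + s • n - b) (y - b) = ‖y - b‖ ^ 2 + s * inner ℝ n (y - b) := by
    rw [show y + s • n - b = (y - b) + s • n by abel, inner_add_left, real_inner_self_eq_norm_sq,
      real_inner_smul_left]
  rw [e] at h3
  rw [ha.infDist_eq, hb.infDist_eq, dist_eq_norm, dist_eq_norm]
  have hposb : 0 < ‖y - b‖ := hpos.trans_le h2
  have h4 : ‖y - b‖ * (‖y - b‖ + c * s) ≤ ‖y - b‖ * ‖y + s • n - b‖ := by nlinarith
  have h5 := le_of_mul_le_mul_left h4 hposb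
  linarith

/-- A maximizer over the ball of `infDist y S - c * dist y z` lies on the boundary sphere, since in
the interior the distance function has slope `1 > c`. -/
theorem exists_infDist_ge_mul {D : ℕ} {S : Set (RD D)} (hS : IsCompact S) {τ : ℝ}
    (hU : ∀ x, Metric.infDist x S < τ → ∃! p, IsNearestPoint S x p) {z : RD D} {ε c : ℝ}
    (hz : 0 < Metric.infDist z S) (hε : 0 < ε) (hτ : Metric.infDist z S + ε < τ)
    (hc0 : 0 < c) (hc1 : c < 1) :
    ∃ y ∈ Metric.closedBall z ε, Metric.infDist z S + c * ε ≤ Metric.infDist y S := by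
  obtain ⟨y, hy, hmax⟩ := (isCompact_closedBall z ε).exists_isMaxOn
    ⟨z, Metric.mem_closedBall_self hε.le⟩ (f := fun y => Metric.infDist y S - c * dist y z)
    ((Metric.continuous_infDist_pt S).sub (by fun_prop)).continuousOn
  have h0 : Metric.infDist z S - c * dist z z ≤ Metric.infDist y S - c * dist y z :=
    hmax (Metric.mem_closedBall_self hε.le)
  rw [dist_self] at h0
  have hyε : dist y z ≤ ε := hy
  have hd : 0 ≤ c * dist y z := by positivity
  have hle : Metric.infDist y S ≤ Metric.infDist z S + dist y z := Metric.infDist_le_infDist_add_dist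
  refine ⟨y, hy, ?_⟩
  rcases hyε.lt_or_eq with hlt | heq
  · exfalso
    obtain ⟨a, ha, huniq⟩ := hU y (by linarith)
    have hapos : 0 < ‖y - a‖ := by
      rw [← dist_eq_norm, ← ha.infDist_eq]; linarith
    obtain ⟨s₀, hs₀, hs⟩ := infDist_slope hS ha huniq hapos (c := (1 + c) / 2) (by linarith)
    set s := min (s₀ / 2) (ε - dist y z) with hsdef
    have hspos : 0 < s := lt_min (by linarith) (by linarith)
    have hs1 := hs s hspos ((min_le_left _ _).trans_lt (by linarith))
    set w := y + s • (‖y - a‖⁻¹ • (y - a)) with hw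
    have hwy : dist w y = s := by
      rw [hw, dist_eq_norm, add_sub_cancel_left, norm_smul, norm_smul, norm_inv, norm_norm,
        inv_mul_cancel₀ hapos.ne', mul_one, Real.norm_of_nonneg hspos.le]
    have hwz : dist w z ≤ s + dist y z := hwy ▸ dist_triangle w y z
    have hsε : s ≤ ε - dist y z := min_le_right _ _
    have h1 : Metric.infDist w S - c * dist w z ≤ Metric.infDist y S - c * dist y z :=
      hmax (Metric.mem_closedBall.2 (by linarith))
    nlinarith
  · rw [heq] at h0
    linarith

/-- Inside the reach, distances to `S` at `ε` from `z` attain the largest conceivable value. This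
replaces the gradient flow of the distance function in Federer's argument. -/
theorem exists_infDist_ge {D : ℕ} {S : Set (RD D)} (hS : IsCompact S) {τ : ℝ}
    (hU : ∀ x, Metric.infDist x S < τ → ∃! p, IsNearestPoint S x p) {z : RD D} {ε : ℝ}
    (hz : 0 < Metric.infDist z S) (hε : 0 < ε) (hτ : Metric.infDist z S + ε < τ) :
    ∃ y ∈ Metric.closedBall z ε, Metric.infDist z S + ε ≤ Metric.infDist y S := by
  obtain ⟨y, hy, hmax⟩ := (isCompact_closedBall z ε).exists_isMaxOn
    ⟨z, Metric.mem_closedBall_self hε.le⟩ (f := fun y => Metric.infDist y S)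
    (Metric.continuous_infDist_pt S).continuousOn
  refine ⟨y, hy, ?_⟩
  by_contra! hcon
  set m := Metric.infDist y S
  set h := Metric.infDist z S
  have hm : h ≤ m := hmax (Metric.mem_closedBall_self hε.le)
  -- a proportion `c < 1` for which `h + c * ε` still exceeds `m`
  set c := ((m - h) / ε + 1) / 2 with hc
  have h1 : (m - h) / ε < 1 := by rw [div_lt_one hε]; linarith
  have h0 : 0 ≤ (m - h) / ε := div_nonneg (by linarith) hε.le
  obtain ⟨w, hw, hwge⟩ := exists_infDist_ge_mul hS hU hz hε hτ (c := c) (by linarith) (by linarith)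
  have h2 : Metric.infDist w S ≤ m := hmax hw
  have h3 : (m - h) / ε * ε < c * ε := by
    apply mul_lt_mul_of_pos_right _ hε
    linarith
  rw [div_mul_cancel₀ _ hε.ne'] at h3
  linarith

/-- A vector from a nearest point is a proximal normal up to the full reach: the ball of radius `τ`
touching `S` at `a` in the direction `z - a` contains no point of `S`. -/
theorem inner_le_of_isNearestPoint {D : ℕ} {S : Set (RD D)} (hS : IsCompact S) {τ : ℝ}
    (hU : ∀ x, Metric.infDist x S < τ → ∃! p, IsNearestPoint S x p) {z a b : RD D}
    (hz : Metric.infDist z S < τ) (ha : IsNearestPoint S z a) (hb : b ∈ S) :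
    2 * τ * inner ℝ (z - a) (b - a) ≤ ‖z - a‖ * ‖b - a‖ ^ 2 := by
  have hh : Metric.infDist z S = ‖z - a‖ := by rw [ha.infDist_eq, dist_eq_norm]
  rcases (norm_nonneg (z - a)).eq_or_lt with h0 | hpos
  · have : z - a = 0 := norm_eq_zero.1 h0.symm
    simp [this]
  have key : ∀ t, ‖z - a‖ < t → t < τ →
      2 * t * inner ℝ (z - a) (b - a) ≤ ‖z - a‖ * ‖b - a‖ ^ 2 := by
    intro t ht1 ht2
    have ht0 : 0 ≤ t := hpos.le.trans ht1.le
    obtain ⟨z₁, hz₁, hz₁d⟩ := exists_infDist_ge hS hU (z := z) (ε := t - ‖z - a‖)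
      (by rw [hh]; exact hpos) (by linarith) (by linarith)
    set h := ‖z - a‖ with hhdef
    rw [hh] at hz₁d
    have hv : ‖z₁ - z‖ ≤ t - h := by simpa [dist_eq_norm] using hz₁
    have hda : t ≤ ‖z₁ - a‖ := by
      have := Metric.infDist_le_dist_of_mem (x := z₁) ha.1
      rw [dist_eq_norm] at this; linarith
    have hdb : t ≤ ‖z₁ - b‖ := by
      have := Metric.infDist_le_dist_of_mem (x := z₁) hb
      rw [dist_eq_norm] at this; linarith
    have e1 : ‖z₁ - a‖ ^ 2 = ‖z₁ - z‖ ^ 2 + 2 * inner ℝ (z₁ - z) (z - a) + h ^ 2 := by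
      rw [← sub_add_sub_cancel z₁ z a, norm_add_sq_real]
    have hv2 : ‖z₁ - z‖ ^ 2 ≤ (t - h) ^ 2 := by gcongr
    have hda2 : t ^ 2 ≤ ‖z₁ - a‖ ^ 2 := by gcongr
    have hinner : (t - h) * h ≤ inner ℝ (z₁ - z) (z - a) := by nlinarith
    -- equality in the triangle inequality puts `z₁` on the ray from `a` through `z`
    have hray : ‖h • (z₁ - z) - (t - h) • (z - a)‖ ^ 2 ≤ 0 := by
      rw [norm_sub_sq_real, norm_smul, norm_smul, inner_smul_left, inner_smul_right,
        Real.norm_of_nonneg hpos.le, Real.norm_of_nonneg (by linarith : 0 ≤ t - h)]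
      simp only [conj_trivial, ← hhdef]
      nlinarith [mul_le_mul_of_nonneg_left hv2 (sq_nonneg h),
        mul_le_mul_of_nonneg_left hinner (mul_nonneg hpos.le (by linarith : 0 ≤ t - h))]
    have hray0 : h • (z₁ - z) - (t - h) • (z - a) = 0 := by
      rw [← norm_eq_zero]; exact pow_eq_zero_iff two_ne_zero |>.1 (le_antisymm hray (sq_nonneg _))
    have hz1a : h • (z₁ - a) = t • (z - a) := by
      have : h • (z₁ - z) = (t - h) • (z - a) := sub_eq_zero.1 hray0
      rw [← sub_add_sub_cancel z₁ z a, smul_add, this, ← add_smul]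
      simp
    have e2 : ‖z₁ - b‖ ^ 2 = ‖z₁ - a‖ ^ 2 - 2 * inner ℝ (z₁ - a) (b - a) + ‖b - a‖ ^ 2 := by
      rw [← sub_sub_sub_cancel_right z₁ b a, norm_sub_sq_real]
    have e3 : h * inner ℝ (z₁ - a) (b - a) = t * inner ℝ (z - a) (b - a) := by
      rw [← real_inner_smul_left, hz1a, real_inner_smul_left]
    have e4 : ‖z₁ - a‖ ≤ t := by
      have := norm_add_le (z₁ - z) (z - a)
      rw [sub_add_sub_cancel] at this
      linarith
    have e5 : ‖z₁ - a‖ ^ 2 ≤ t ^ 2 := by gcongr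
    have hdb2 : t ^ 2 ≤ ‖z₁ - b‖ ^ 2 := by gcongr
    have e6 : 2 * inner ℝ (z₁ - a) (b - a) ≤ ‖b - a‖ ^ 2 := by linarith
    nlinarith
  by_contra! hcon
  rw [hh] at hz
  set g : ℝ := inner ℝ (z - a) (b - a) with hg
  have hB : 0 ≤ ‖z - a‖ * ‖b - a‖ ^ 2 := by positivity
  have hτpos : 0 < τ := hpos.trans hz
  have hgpos : 0 < g := by
    by_contra! hg0
    nlinarith
  set q := ‖z - a‖ * ‖b - a‖ ^ 2 / (2 * g) with hq
  have hqτ : q < τ := by rw [hq, div_lt_iff₀ (by positivity)]; linarith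
  have hm : max ‖z - a‖ q < τ := max_lt hz hqτ
  have h1 := key ((max ‖z - a‖ q + τ) / 2) (by linarith [le_max_left ‖z - a‖ q]) (by linarith)
  have h2 : q < (max ‖z - a‖ q + τ) / 2 := by linarith [le_max_right ‖z - a‖ q]
  have h3 : q * (2 * g) = ‖z - a‖ * ‖b - a‖ ^ 2 := div_mul_cancel₀ _ (by positivity)
  nlinarith

/-! ### Charts and tangent spaces -/

open Filter Topology Asymptotics in
/-- A chart of `S` around `x`, with the embedding property recorded as an equality of filters. -/
theorem IsSubmanifold.exists_chart {D k d : ℕ} {S : Set (RD D)} (hk : 1 ≤ k)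
    (hS : IsSubmanifold k d S) {x : RD D} (hx : x ∈ S) :
    ∃ (f : RD d → RD D) (v₀ : RD d), f v₀ = x ∧ ContinuousAt (fderiv ℝ f) v₀ ∧
      ∀ᶠ v in 𝓝 v₀, DifferentiableAt ℝ f v ∧ Function.Injective (fderiv ℝ f v) ∧
        map f (𝓝 v) = 𝓝[S] (f v) := by
  obtain ⟨U, V, f, hU, hxU, hV, hf, hinj, hemb, himg⟩ := hS x hx
  obtain ⟨v₀, hv₀, rfl⟩ : x ∈ f '' V := himg ▸ ⟨hx, hxU⟩
  have hk1 : (1 : WithTop ℕ∞) ≤ (k : WithTop ℕ∞) := by exact_mod_cast hk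
  refine ⟨f, v₀, rfl, (hf.continuousOn_fderiv_of_isOpen hV hk1).continuousAt (hV.mem_nhds hv₀), ?_⟩
  filter_upwards [hV.mem_nhds hv₀] with v hv
  refine ⟨(hf.differentiableOn (by positivity)).differentiableAt (hV.mem_nhds hv), hinj v hv, ?_⟩
  have h1 := hemb.map_nhds_eq ⟨v, hv⟩
  have hrange : Set.range (V.domRestrict f) = S ∩ U := by
    rw [← himg]; ext y; simp
  rw [hrange] at h1
  have hvU : f v ∈ U := by
    have : f v ∈ f '' V := ⟨v, hv, rfl⟩
    rw [himg] at this; exact this.2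
  have h2 : map ((↑) : V → RD d) (𝓝 ⟨v, hv⟩) = 𝓝 v := by
    rw [map_nhds_subtype_coe_eq_nhds hv (hV.mem_nhds hv)]
  rw [← h2, map_map]
  have h3 : f ∘ ((↑) : V → RD d) = V.domRestrict f := rfl
  rw [h3, h1]
  exact nhdsWithin_inter_of_mem' (mem_nhdsWithin_of_mem_nhds (hU.mem_nhds hvU))

open Filter Topology Asymptotics in
/-- Near `f v`, the set `S` is tangent to the range of the derivative of a chart at `v`. -/
theorem chart_isLittleO {D d : ℕ} {S : Set (RD D)} {f : RD d → RD D} {v : RD d}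
    (hf : DifferentiableAt ℝ f v) (hinj : Function.Injective (fderiv ℝ f v))
    (hmap : map f (𝓝 v) = 𝓝[S] (f v)) :
    (fun a => (a - f v) - (LinearMap.range (fderiv ℝ f v : RD d →ₗ[ℝ] RD D)).starProjection
      (a - f v)) =o[𝓝[S] (f v)] fun a => a - f v := by
  set A := fderiv ℝ f v with hA
  set L := LinearMap.range (A : RD d →ₗ[ℝ] RD D) with hL
  rw [← hmap, isLittleO_map]
  have h1 : (fun v' => f v' - f v - A (v' - v)) =o[𝓝 v] fun v' => v' - v :=
    hf.hasFDerivAt.isLittleO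
  obtain ⟨K, hKpos, hK⟩ := (A : RD d →ₗ[ℝ] RD D).exists_antilipschitzWith
    (LinearMap.ker_eq_bot.2 hinj)
  have h2 : (fun v' => v' - v) =O[𝓝 v] fun v' => A (v' - v) := by
    refine IsBigO.of_bound K (Eventually.of_forall fun v' => ?_)
    simpa [dist_eq_norm] using hK.le_mul_dist (v' - v) 0
  have h3 : (fun v' => f v' - f v - A (v' - v)) =o[𝓝 v] fun v' => A (v' - v) := h1.trans_isBigO h2
  have h4 : (fun v' => A (v' - v)) =O[𝓝 v] fun v' => f v' - f v := by
    have := h3.right_isBigO_add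
    simpa using this
  refine IsBigO.trans_isLittleO (IsBigO.of_bound 1 (Eventually.of_forall fun v' => ?_))
    (h3.trans_isBigO h4)
  rw [one_mul]
  exact norm_sub_starProjection_le L _ ⟨v' - v, rfl⟩

open Filter Topology Asymptotics in
theorem tangentSpaceAt_chart {D d : ℕ} {S : Set (RD D)} {f : RD d → RD D} {v : RD d}
    (hf : DifferentiableAt ℝ f v) (hinj : Function.Injective (fderiv ℝ f v))
    (hmap : map f (𝓝 v) = 𝓝[S] (f v)) :
    tangentSpaceAt S (f v) = LinearMap.range (fderiv ℝ f v : RD d →ₗ[ℝ] RD D) := by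
  set A := fderiv ℝ f v with hA
  set L := LinearMap.range (A : RD d →ₗ[ℝ] RD D) with hL
  apply le_antisymm
  · refine Submodule.span_le.2 ?_
    rintro w ⟨γ, hγ0, hγS, hγ⟩
    have ht : Tendsto γ (𝓝 0) (𝓝[S] (f v)) :=
      tendsto_nhdsWithin_iff.2 ⟨hγ0 ▸ hγ.continuousAt.tendsto, hγS⟩
    -- the component of the velocity normal to `L` is the derivative of an `o(t)`
    let Q : RD D →L[ℝ] RD D := ContinuousLinearMap.id ℝ _ - L.starProjection
    have h1 : (fun t => Q (γ t - f v)) =o[𝓝 0] fun t => γ t - f v :=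
      (chart_isLittleO hf hinj hmap).comp_tendsto ht
    have h2 : (fun t => γ t - f v) =O[𝓝 0] fun t : ℝ => t := by
      have := hγ.differentiableAt.isBigO_sub
      simpa [hγ0] using this
    have h3 : HasDerivAt (fun t => Q (γ t - f v)) (Q w) 0 :=
      Q.hasFDerivAt.comp_hasDerivAt 0 (hγ.sub_const (f v))
    have h4 : HasDerivAt (fun t => Q (γ t - f v)) 0 0 := by
      rw [hasDerivAt_iff_isLittleO]
      simpa [hγ0] using h1.trans_isBigO h2
    have h5 : w - L.starProjection w = 0 := h3.unique h4
    exact L.starProjection_eq_self_iff.1 (sub_eq_zero.1 h5).symm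
  · rintro _ ⟨e, rfl⟩
    refine Submodule.subset_span ⟨fun t => f (v + t • e), by simp, ?_, ?_⟩
    · have h1 : Tendsto (fun t : ℝ => v + t • e) (𝓝 0) (𝓝 v) := by
        have : Continuous fun t : ℝ => v + t • e := by fun_prop
        simpa using this.tendsto 0
      have h2 : ∀ᶠ v' in 𝓝 v, f v' ∈ S := by
        have : ∀ᶠ a in map f (𝓝 v), a ∈ S := hmap ▸ self_mem_nhdsWithin
        exact this
      exact h1.eventually h2
    · have h1 : HasDerivAt (fun t : ℝ => v + t • e) e 0 := by
        simpa using ((hasDerivAt_id (0 : ℝ)).smul_const e).const_add v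
      have h2 : HasFDerivAt f A (v + (0 : ℝ) • e) := by simpa using hf.hasFDerivAt
      exact h2.comp_hasDerivAt 0 h1

theorem IsSubmanifold.finrank_tangentSpaceAt {D k d : ℕ} {S : Set (RD D)} (hk : 1 ≤ k)
    (hS : IsSubmanifold k d S) {x : RD D} (hx : x ∈ S) :
    Module.finrank ℝ (tangentSpaceAt S x) = d := by
  obtain ⟨f, v₀, rfl, -, hev⟩ := hS.exists_chart hk hx
  obtain ⟨hf, hinj, hmap⟩ := hev.self_of_nhds
  rw [tangentSpaceAt_chart hf hinj hmap, LinearMap.finrank_range_of_inj hinj]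
  simp

open Filter Topology Asymptotics in
theorem IsSubmanifold.isLittleO {D k d : ℕ} {S : Set (RD D)} (hk : 1 ≤ k)
    (hS : IsSubmanifold k d S) {x : RD D} (hx : x ∈ S) :
    (fun a => (a - x) - (tangentSpaceAt S x).starProjection (a - x)) =o[𝓝[S] x]
      fun a => a - x := by
  obtain ⟨f, v₀, rfl, -, hev⟩ := hS.exists_chart hk hx
  obtain ⟨hf, hinj, hmap⟩ := hev.self_of_nhds
  rw [tangentSpaceAt_chart hf hinj hmap]
  exact chart_isLittleO hf hinj hmap

open Filter Topology in
/-- Tangent spaces are lower semicontinuous: a tangent vector at `x` is a limit of tangent vectors at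
nearby points. -/
theorem IsSubmanifold.tendsto_tangentSpaceAt {D k d : ℕ} {S : Set (RD D)} (hk : 1 ≤ k)
    (hS : IsSubmanifold k d S) {x : RD D} (hx : x ∈ S) {w : RD D} (hw : w ∈ tangentSpaceAt S x) :
    Tendsto (fun a => ‖w - (tangentSpaceAt S a).starProjection w‖) (𝓝[S] x) (𝓝 0) := by
  obtain ⟨f, v₀, rfl, hcont, hev⟩ := hS.exists_chart hk hx
  obtain ⟨hf, hinj, hmap⟩ := hev.self_of_nhds
  rw [tangentSpaceAt_chart hf hinj hmap] at hw
  obtain ⟨e, rfl⟩ := hw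
  rw [← hmap, tendsto_map'_iff]
  have h1 : Tendsto (fun v => ‖fderiv ℝ f v₀ e - fderiv ℝ f v e‖) (𝓝 v₀) (𝓝 0) := by
    have h2 : ContinuousAt (fun v => ‖fderiv ℝ f v₀ e - fderiv ℝ f v e‖) v₀ :=
      (continuousAt_const.sub (hcont.clm_apply continuousAt_const)).norm
    simpa using h2.tendsto
  refine squeeze_zero' (Eventually.of_forall fun _ => norm_nonneg _) ?_ h1
  filter_upwards [hev] with v hv
  refine norm_sub_starProjection_le _ _ ?_
  rw [tangentSpaceAt_chart hv.1 hv.2.1 hv.2.2]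
  exact ⟨e, rfl⟩

open Filter Topology in
/-- First-order condition: at a minimum over `S` of a differentiable function, its derivative
vanishes on the tangent space. -/
theorem fderiv_eq_zero_of_isLocalMin {D : ℕ} {S : Set (RD D)} {x : RD D} {g : RD D → ℝ}
    (hg : DifferentiableAt ℝ g x) (hmin : ∀ᶠ a in 𝓝[S] x, g x ≤ g a) {w : RD D}
    (hw : w ∈ tangentSpaceAt S x) : fderiv ℝ g x w = 0 := by
  have : tangentSpaceAt S x ≤ LinearMap.ker (fderiv ℝ g x : RD D →ₗ[ℝ] ℝ) := by
    refine Submodule.span_le.2 ?_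
    rintro w ⟨γ, rfl, hγS, hγ⟩
    have h1 : HasDerivAt (g ∘ γ) (fderiv ℝ g (γ 0) w) 0 := hg.hasFDerivAt.comp_hasDerivAt 0 hγ
    have h2 : IsLocalMin (g ∘ γ) 0 := by
      have ht : Tendsto γ (𝓝 0) (𝓝[S] (γ 0)) :=
        tendsto_nhdsWithin_iff.2 ⟨hγ.continuousAt.tendsto, hγS⟩
      exact ht.eventually hmin
    exact h2.hasDerivAt_eq_zero h1
  exact this hw

theorem sub_mem_orthogonal_of_isNearestPoint {D : ℕ} {S : Set (RD D)} {z a : RD D}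
    (h : IsNearestPoint S z a) : z - a ∈ (tangentSpaceAt S a)ᗮ := by
  rw [Submodule.mem_orthogonal']
  intro w hw
  have hd : HasFDerivAt (fun y : RD D => ‖z - y‖ ^ 2)
      (2 • (innerSL ℝ (z - a)).comp (-ContinuousLinearMap.id ℝ (RD D))) a :=
    ((hasFDerivAt_id a).const_sub z).norm_sq
  have h1 := fderiv_eq_zero_of_isLocalMin (S := S) (x := a) hd.differentiableAt ?_ hw
  · rw [hd.fderiv] at h1
    simp only [inner_sub_left] at h1 ⊢
    simp at h1
    linarith
  · filter_upwards [self_mem_nhdsWithin] with b hb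
    have := h.2 b hb
    rw [dist_eq_norm, dist_eq_norm] at this
    gcongr

/-! ### Quadratic approximation by tangent spaces and local graphs -/

open Filter Topology Asymptotics in
/-- All normal vectors of a submanifold, not only those coming from nearest points, are proximal up
to the reach: the nearest points to `x + s • n` are within `o(s)` of `x`. -/
theorem inner_le_of_mem_orthogonal {D k d : ℕ} {S : Set (RD D)} (hS : IsCompact S) (hk : 1 ≤ k)
    (hM : IsSubmanifold k d S) {τ : ℝ} (hτ : 0 < τ)
    (hU : ∀ x, Metric.infDist x S < τ → ∃! p, IsNearestPoint S x p) {x b n : RD D} (hx : x ∈ S)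
    (hb : b ∈ S) (hn : n ∈ (tangentSpaceAt S x)ᗮ) :
    2 * τ * inner ℝ n (b - x) ≤ ‖n‖ * ‖b - x‖ ^ 2 := by
  choose a ha using fun s : ℝ => exists_isNearestPoint hS ⟨x, hx⟩ (x + s • n)
  have hza : ∀ s, 0 < s → ‖x + s • n - a s‖ ≤ s * ‖n‖ := by
    intro s hs
    have h1 := (ha s).2 x hx
    rwa [dist_eq_norm, dist_eq_norm, add_sub_cancel_left, norm_smul,
      Real.norm_of_nonneg hs.le] at h1
  have hax : ∀ s, 0 < s → ‖a s - x‖ ≤ 2 * s * ‖n‖ := by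
    intro s hs
    have h1 : ‖a s - x‖ ≤ ‖s • n‖ + ‖x + s • n - a s‖ := by
      have := norm_sub_le (s • n) (x + s • n - a s)
      rwa [show s • n - (x + s • n - a s) = a s - x by abel] at this
    rw [norm_smul, Real.norm_of_nonneg hs.le] at h1
    linarith [hza s hs]
  have hat : Tendsto a (𝓝[>] 0) (𝓝[S] x) := by
    refine tendsto_nhdsWithin_iff.2 ⟨?_, Eventually.of_forall fun s => (ha s).1⟩
    rw [tendsto_iff_norm_sub_tendsto_zero]
    have h2 : Tendsto (fun s : ℝ => 2 * s * ‖n‖) (𝓝[>] 0) (𝓝 0) := by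
      have : Continuous fun s : ℝ => 2 * s * ‖n‖ := by fun_prop
      simpa using (this.tendsto 0).mono_left nhdsWithin_le_nhds
    refine squeeze_zero' (Eventually.of_forall fun _ => norm_nonneg _) ?_ h2
    filter_upwards [self_mem_nhdsWithin] with s hs using hax s hs
  have hlo : (fun s => a s - x) =o[𝓝[>] 0] fun s : ℝ => s := by
    rw [isLittleO_iff]
    intro c hc
    have h1 := (hM.isLittleO hk hx).comp_tendsto hat
    rw [isLittleO_iff] at h1
    filter_upwards [h1 (c := c / (2 * (‖n‖ + 1))) (by positivity), self_mem_nhdsWithin]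
      with s hs1 hs
    have hs0 : 0 < s := hs
    simp only [Function.comp_apply] at hs1
    set v := a s - x with hv
    have h2 : ‖v‖ ^ 2 ≤ 2 * s * inner ℝ n v := by
      have h3 := hza s hs0
      have h4 : ‖s • n - v‖ ^ 2 ≤ (s * ‖n‖) ^ 2 := by
        rw [show s • n - v = x + s • n - a s by rw [hv]; abel]
        gcongr
      rw [norm_sub_sq_real, norm_smul, real_inner_smul_left, Real.norm_of_nonneg hs0.le] at h4
      nlinarith
    have h5 : inner ℝ n v = inner ℝ n (v - (tangentSpaceAt S x).starProjection v) := by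
      rw [inner_sub_right n v, Submodule.inner_left_of_mem_orthogonal
        (Submodule.starProjection_apply_mem _ _) hn, sub_zero]
    have h6 := real_inner_le_norm n (v - (tangentSpaceAt S x).starProjection v)
    rw [Real.norm_of_nonneg hs0.le]
    rcases (norm_nonneg v).eq_or_lt with h0 | hpos
    · rw [← h0]; positivity
    have h7 : ‖n‖ * (c / (2 * (‖n‖ + 1))) ≤ c / 2 := by
      rw [← mul_div_assoc, div_le_div_iff₀ (by positivity) two_pos]
      nlinarith
    have h8 : inner ℝ n v ≤ c / 2 * ‖v‖ := by
      rw [h5]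
      refine h6.trans ?_
      calc ‖n‖ * ‖v - (tangentSpaceAt S x).starProjection v‖
          ≤ ‖n‖ * (c / (2 * (‖n‖ + 1)) * ‖v‖) := by gcongr
        _ = ‖n‖ * (c / (2 * (‖n‖ + 1))) * ‖v‖ := by ring
        _ ≤ c / 2 * ‖v‖ := by gcongr
    have h9 : ‖v‖ * ‖v‖ ≤ (c * s) * ‖v‖ := by nlinarith
    exact le_of_mul_le_mul_right h9 hpos
  have hquot : Tendsto (fun s : ℝ => s⁻¹ • (a s - x)) (𝓝[>] 0) (𝓝 0) :=
    hlo.tendsto_inv_smul_nhds_zero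
  have hat' : Tendsto a (𝓝[>] 0) (𝓝 x) := hat.mono_right nhdsWithin_le_nhds
  have hL : Tendsto (fun s : ℝ => 2 * τ * inner ℝ (n - s⁻¹ • (a s - x)) (b - a s)) (𝓝[>] 0)
      (𝓝 (2 * τ * inner ℝ (n - 0) (b - x))) :=
    ((tendsto_const_nhds.sub hquot).inner (tendsto_const_nhds.sub hat')).const_mul _
  have hR : Tendsto (fun s : ℝ => ‖n‖ * ‖b - a s‖ ^ 2) (𝓝[>] 0) (𝓝 (‖n‖ * ‖b - x‖ ^ 2)) :=
    (((tendsto_const_nhds.sub hat').norm).pow 2).const_mul _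
  rw [sub_zero] at hL
  refine le_of_tendsto_of_tendsto hL hR ?_
  have hsmall : ∀ᶠ s : ℝ in 𝓝[>] 0, s * ‖n‖ < τ := by
    have h1 : Tendsto (fun s : ℝ => s * ‖n‖) (𝓝[>] 0) (𝓝 0) := by
      have : Continuous fun s : ℝ => s * ‖n‖ := by fun_prop
      simpa using (this.tendsto 0).mono_left nhdsWithin_le_nhds
    exact h1.eventually_lt_const hτ
  filter_upwards [hsmall, self_mem_nhdsWithin] with s hs hs0
  have hs0 : 0 < s := hs0
  have h1 := inner_le_of_isNearestPoint hS hU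
    (by rw [(ha s).infDist_eq, dist_eq_norm]; exact (hza s hs0).trans_lt hs) (ha s) hb
  have h2 : x + s • n - a s = s • (n - s⁻¹ • (a s - x)) := by
    rw [smul_sub, smul_inv_smul₀ hs0.ne']; abel
  have h3 : ‖x + s • n - a s‖ * ‖b - a s‖ ^ 2 ≤ s * ‖n‖ * ‖b - a s‖ ^ 2 := by
    gcongr; exact hza s hs0
  have h4 := h1.trans h3
  rw [h2, real_inner_smul_left] at h4
  have h5 : s * (2 * τ * inner ℝ (n - s⁻¹ • (a s - x)) (b - a s))
      ≤ s * (‖n‖ * ‖b - a s‖ ^ 2) := by linarith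
  exact le_of_mul_le_mul_left h5 hs0

/-- Federer's estimate: `S` leaves its tangent spaces at most quadratically, with constant
`1 / (2 τ)`. -/
theorem norm_sub_starProjection_tangentSpaceAt_le {D k d : ℕ} {S : Set (RD D)} (hS : IsCompact S)
    (hk : 1 ≤ k) (hM : IsSubmanifold k d S) {τ : ℝ} (hτ : 0 < τ)
    (hU : ∀ x, Metric.infDist x S < τ → ∃! p, IsNearestPoint S x p) {x b : RD D} (hx : x ∈ S)
    (hb : b ∈ S) :
    ‖(b - x) - (tangentSpaceAt S x).starProjection (b - x)‖ ≤ ‖b - x‖ ^ 2 / (2 * τ) := by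
  set T := tangentSpaceAt S x
  set n := (b - x) - T.starProjection (b - x) with hn
  have hnT : n ∈ Tᗮ := T.sub_starProjection_mem_orthogonal _
  have h1 := inner_le_of_mem_orthogonal hS hk hM hτ hU hx hb hnT
  have h2 : inner ℝ n (b - x) = ‖n‖ ^ 2 := by
    have h3 : b - x = n + T.starProjection (b - x) := by rw [hn]; abel
    conv_lhs => rw [h3]
    rw [inner_add_right, Submodule.inner_left_of_mem_orthogonal
        (Submodule.starProjection_apply_mem _ _) hnT, real_inner_self_eq_norm_sq, add_zero]
  rw [h2] at h1
  rw [le_div_iff₀ (by positivity)]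
  rcases (norm_nonneg n).eq_or_lt with h0 | hpos
  · rw [← h0, zero_mul]; positivity
  · have h3 : ‖n‖ * (‖n‖ * (2 * τ)) ≤ ‖n‖ * ‖b - x‖ ^ 2 := by linarith
    exact le_of_mul_le_mul_left h3 hpos

/-- As long as no tangent vector at `x` is normal to `S` at a point within `R` of `x`, the projection
of `S` to the tangent space at `x` covers a ball: a point of `S` whose projection is nearest to the
target solves the first-order condition only if it hits the target. -/
theorem exists_starProjection_eq {D : ℕ} {S : Set (RD D)} (hS : IsCompact S) {τ R : ℝ} (hR : 0 < R)
    (hRτ : R ≤ τ / 8) {x : RD D} (hx : x ∈ S)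
    (hQ : ∀ b ∈ S, ‖(b - x) - (tangentSpaceAt S x).starProjection (b - x)‖
      ≤ ‖b - x‖ ^ 2 / (2 * τ))
    (hA : ∀ a ∈ S, ‖a - x‖ ≤ R → ∀ w ∈ tangentSpaceAt S x, w ∈ (tangentSpaceAt S a)ᗮ → w = 0)
    {t : RD D} (ht : t ∈ tangentSpaceAt S x) (htR : ‖t‖ ≤ R / 3) :
    ∃ a ∈ S, ‖a - x‖ ≤ R ∧ (tangentSpaceAt S x).starProjection (a - x) = t := by
  set T := tangentSpaceAt S x with hT
  have hK : IsCompact (S ∩ Metric.closedBall x R) := hS.inter_right Metric.isClosed_closedBall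
  have hcont : Continuous fun a : RD D => ‖T.starProjection (a - x) - t‖ ^ 2 := by fun_prop
  obtain ⟨a, ⟨haS, haR⟩, hmin⟩ := hK.exists_isMinOn
    ⟨x, hx, Metric.mem_closedBall_self hR.le⟩ hcont.continuousOn
  have haR' : ‖a - x‖ ≤ R := by simpa [dist_eq_norm] using haR
  refine ⟨a, haS, haR', ?_⟩
  set m := T.starProjection (a - x) - t with hm
  have h0 : ‖m‖ ≤ ‖t‖ := by
    have h1 : ‖m‖ ^ 2 ≤ ‖T.starProjection (x - x) - t‖ ^ 2 :=
      hmin ⟨hx, Metric.mem_closedBall_self hR.le⟩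
    rw [sub_self, map_zero, zero_sub, norm_neg] at h1
    exact le_of_sq_le_sq h1 (norm_nonneg _)
  have hlt : ‖a - x‖ < R := by
    refine lt_of_le_of_ne haR' fun heq => ?_
    have h1 := hQ a haS
    have h2 : ‖T.starProjection (a - x)‖ ≤ ‖m‖ + ‖t‖ := by
      have := norm_add_le m t
      rwa [hm, sub_add_cancel] at this
    have h3 : ‖a - x‖ ≤ ‖T.starProjection (a - x)‖ + ‖(a - x) - T.starProjection (a - x)‖ := by
      have := norm_add_le (T.starProjection (a - x)) ((a - x) - T.starProjection (a - x))
      rwa [add_sub_cancel] at this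
    rw [heq] at h1 h3
    have h4 : R ^ 2 / (2 * τ) ≤ R / 16 := by
      rw [div_le_div_iff₀ (by linarith) (by norm_num)]
      nlinarith
    linarith
  have hmT : m ∈ T := T.sub_mem (T.starProjection_apply_mem _) ht
  have hmorth : m ∈ (tangentSpaceAt S a)ᗮ := by
    rw [Submodule.mem_orthogonal']
    intro w hw
    have hd : HasFDerivAt (fun y : RD D => ‖T.starProjection (y - x) - t‖ ^ 2)
        (2 • (innerSL ℝ m).comp T.starProjection) a := by
      have h1 : HasFDerivAt (fun y : RD D => T.starProjection (y - x) - t) T.starProjection a := by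
        have := T.starProjection.hasFDerivAt.comp a ((hasFDerivAt_id a).sub_const x)
        simpa using this.sub_const t
      exact h1.norm_sq
    have h1 := fderiv_eq_zero_of_isLocalMin (S := S) (x := a) hd.differentiableAt ?_ hw
    · rw [hd.fderiv] at h1
      have h2 : inner ℝ m (T.starProjection w) = 0 := by simpa using h1
      rwa [inner_starProjection_of_mem hmT] at h2
    · have h2 : Metric.ball x R ∈ nhds a :=
        Metric.isOpen_ball.mem_nhds (by simpa [dist_eq_norm] using hlt)
      filter_upwards [self_mem_nhdsWithin, mem_nhdsWithin_of_mem_nhds h2] with b hb hb2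
      exact hmin ⟨hb, Metric.ball_subset_closedBall hb2⟩
  exact sub_eq_zero.1 (hA a haS haR' m hmT hmorth)

theorem norm_sub_starProjection_sub_le {D : ℕ} (K : Submodule ℝ (RD D)) (x y : RD D) :
    ‖(x - y) - K.starProjection (x - y)‖
      ≤ ‖x - K.starProjection x‖ + ‖y - K.starProjection y‖ := by
  rw [map_sub, show x - y - (K.starProjection x - K.starProjection y)
    = (x - K.starProjection x) - (y - K.starProjection y) by abel]
  exact norm_sub_le _ _

theorem norm_sub_starProjection_smul {D : ℕ} (K : Submodule ℝ (RD D)) (c : ℝ) (x : RD D) :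
    ‖c • x - K.starProjection (c • x)‖ = |c| * ‖x - K.starProjection x‖ := by
  rw [map_smul, ← smul_sub, norm_smul, Real.norm_eq_abs]

/-- Where `S` projects onto a ball of the tangent space at `x`, the tangent vectors at `x` are
differences of points of `S` up to a quadratic error, hence nearly tangent at nearby points `y`. -/
theorem norm_sub_starProjection_le_of_surj {D : ℕ} {S : Set (RD D)} {τ R : ℝ} (hR : 0 < R)
    (hτ : 0 < τ) {x y : RD D} (hx : x ∈ S) (hy : y ∈ S) (hxy : ‖y - x‖ ≤ 2 * R)
    (hQ : ∀ x ∈ S, ∀ b ∈ S, ‖(b - x) - (tangentSpaceAt S x).starProjection (b - x)‖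
      ≤ ‖b - x‖ ^ 2 / (2 * τ))
    (hsurj : ∀ t ∈ tangentSpaceAt S x, ‖t‖ ≤ R / 3 →
      ∃ a ∈ S, ‖a - x‖ ≤ R ∧ (tangentSpaceAt S x).starProjection (a - x) = t)
    {w : RD D} (hw : w ∈ tangentSpaceAt S x) :
    ‖w - (tangentSpaceAt S y).starProjection w‖ ≤ 21 * R / τ * ‖w‖ := by
  set T := tangentSpaceAt S y
  rcases eq_or_ne w 0 with rfl | hw0
  · simp
  have hwpos : 0 < ‖w‖ := norm_pos_iff.2 hw0
  set t := (R / 3 / ‖w‖) • w with ht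
  obtain ⟨a, haS, haR, hat⟩ := hsurj t (Submodule.smul_mem _ _ hw) (by
    rw [ht, norm_smul, Real.norm_of_nonneg (by positivity), div_mul_cancel₀ _ hwpos.ne'])
  have h1 := hQ x hx a haS
  have h2 := hQ y hy a haS
  have h3 := hQ y hy x hx
  rw [hat] at h1
  have hay : ‖a - y‖ ≤ 3 * R := by
    have := norm_sub_le (a - x) (y - x)
    rw [sub_sub_sub_cancel_right] at this
    linarith
  have e : t = ((a - y) - (x - y)) - ((a - x) - t) := by abel
  have h4 : ‖t - T.starProjection t‖ ≤ 7 * R ^ 2 / τ := by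
    have h5 := norm_sub_starProjection_sub_le T ((a - y) - (x - y)) ((a - x) - t)
    rw [← e] at h5
    have h6 := norm_sub_starProjection_sub_le T (a - y) (x - y)
    have h7 := norm_sub_starProjection_le_norm T ((a - x) - t)
    rw [norm_sub_rev x y] at h3
    have b1 : ‖a - x‖ ^ 2 / (2 * τ) ≤ R ^ 2 / (2 * τ) := by gcongr
    have b2 : ‖a - y‖ ^ 2 / (2 * τ) ≤ (3 * R) ^ 2 / (2 * τ) := by gcongr
    have b3 : ‖y - x‖ ^ 2 / (2 * τ) ≤ (2 * R) ^ 2 / (2 * τ) := by gcongr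
    have b4 : R ^ 2 / (2 * τ) + (3 * R) ^ 2 / (2 * τ) + (2 * R) ^ 2 / (2 * τ) = 7 * R ^ 2 / τ := by
      field_simp; ring
    linarith
  rw [ht, norm_sub_starProjection_smul, abs_of_pos (by positivity)] at h4
  have h8 : ‖w - T.starProjection w‖
      = 3 * ‖w‖ / R * (R / 3 / ‖w‖ * ‖w - T.starProjection w‖) := by field_simp
  rw [h8]
  calc 3 * ‖w‖ / R * (R / 3 / ‖w‖ * ‖w - T.starProjection w‖)
      ≤ 3 * ‖w‖ / R * (7 * R ^ 2 / τ) := by gcongr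
    _ = 21 * R / τ * ‖w‖ := by field_simp; ring

open Filter Topology in
theorem isCompact_tangent_normal_pairs {D k d : ℕ} {S : Set (RD D)} (hS : IsCompact S) (hk : 1 ≤ k)
    (hM : IsSubmanifold k d S) (x : RD D) (R : ℝ) :
    IsCompact {q : RD D × RD D | q.1 ∈ S ∧ ‖q.1 - x‖ ≤ R ∧ q.2 ∈ tangentSpaceAt S x ∧ ‖q.2‖ = 1 ∧
      q.2 ∈ (tangentSpaceAt S q.1)ᗮ} := by
  refine IsCompact.of_isClosed_subset (hS.prod (isCompact_sphere (0 : RD D) 1)) ?_ ?_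
  · apply IsSeqClosed.isClosed
    intro q q₀ hq hlim
    have h1 : Tendsto (fun j => (q j).1) atTop (𝓝 q₀.1) := (continuous_fst.tendsto q₀).comp hlim
    have h2 : Tendsto (fun j => (q j).2) atTop (𝓝 q₀.2) := (continuous_snd.tendsto q₀).comp hlim
    have hS0 : q₀.1 ∈ S := hS.isClosed.mem_of_tendsto h1 (Eventually.of_forall fun j => (hq j).1)
    refine ⟨hS0, ?_, ?_, ?_, ?_⟩
    · exact le_of_tendsto (h1.sub_const x).norm (Eventually.of_forall fun j => (hq j).2.1)
    · exact (Submodule.closed_of_finiteDimensional (tangentSpaceAt S x)).mem_of_tendsto h2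
        (Eventually.of_forall fun j => (hq j).2.2.1)
    · refine tendsto_nhds_unique h2.norm ?_
      simp only [fun j => (hq j).2.2.2.1]
      exact tendsto_const_nhds
    · rw [Submodule.mem_orthogonal]
      intro u hu
      have h3 : Tendsto (fun j => (q j).1) atTop (𝓝[S] q₀.1) :=
        tendsto_nhdsWithin_iff.2 ⟨h1, Eventually.of_forall fun j => (hq j).1⟩
      have h4 := (hM.tendsto_tangentSpaceAt hk hS0 hu).comp h3
      have h5 : Tendsto (fun j => inner ℝ u (q j).2) atTop (𝓝 0) := by
        refine squeeze_zero_norm (fun j => ?_) h4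
        have h6 : inner ℝ u (q j).2
            = inner ℝ (u - (tangentSpaceAt S (q j).1).starProjection u) (q j).2 := by
          rw [inner_sub_left, Submodule.inner_right_of_mem_orthogonal
            (Submodule.starProjection_apply_mem _ _) (hq j).2.2.2.2, sub_zero]
        rw [h6]
        have h7 := norm_inner_le_norm (𝕜 := ℝ)
          (u - (tangentSpaceAt S (q j).1).starProjection u) (q j).2
        rwa [(hq j).2.2.2.1, mul_one] at h7
      exact tendsto_nhds_unique (tendsto_const_nhds.inner h2) h5
  · rintro q ⟨h1, -, -, h2, -⟩
    exact ⟨h1, by simpa using h2⟩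

/-- Within `τ / 40` of `x`, no tangent vector at `x` is normal to `S`. Otherwise a closest point `a`
with such a vector exists by lower semicontinuity of tangent spaces; `S` is a graph up to half the
distance to `a`, and this already keeps the tangent space at `a` close to that at `x`. -/
theorem eq_zero_of_mem_tangentSpaceAt_of_mem_orthogonal {D k d : ℕ} {S : Set (RD D)}
    (hS : IsCompact S) (hk : 1 ≤ k) (hM : IsSubmanifold k d S) {τ : ℝ} (hτ : 0 < τ)
    (hQ : ∀ x ∈ S, ∀ b ∈ S, ‖(b - x) - (tangentSpaceAt S x).starProjection (b - x)‖
      ≤ ‖b - x‖ ^ 2 / (2 * τ)) {x : RD D} (hx : x ∈ S) :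
    ∀ a ∈ S, ‖a - x‖ ≤ τ / 40 → ∀ w ∈ tangentSpaceAt S x, w ∈ (tangentSpaceAt S a)ᗮ → w = 0 := by
  set Z := {q : RD D × RD D | q.1 ∈ S ∧ ‖q.1 - x‖ ≤ τ / 40 ∧ q.2 ∈ tangentSpaceAt S x ∧
    ‖q.2‖ = 1 ∧ q.2 ∈ (tangentSpaceAt S q.1)ᗮ} with hZ
  have hmemZ : ∀ a ∈ S, ‖a - x‖ ≤ τ / 40 → ∀ w ∈ tangentSpaceAt S x,
      w ∈ (tangentSpaceAt S a)ᗮ → w ≠ 0 → (a, ‖w‖⁻¹ • w) ∈ Z := by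
    intro a ha hax w hw hwo hw0
    refine ⟨ha, hax, Submodule.smul_mem _ _ hw, ?_, Submodule.smul_mem _ _ hwo⟩
    rw [norm_smul, norm_inv, norm_norm, inv_mul_cancel₀ (norm_ne_zero_iff.2 hw0)]
  have hempty : ¬ Z.Nonempty := by
    intro hne
    obtain ⟨⟨a, w⟩, ⟨ha, hax, hwT, hw1, hwo⟩, hmin⟩ :=
      (isCompact_tangent_normal_pairs hS hk hM x (τ / 40)).exists_isMinOn hne
        (f := fun q => ‖q.1 - x‖) (by fun_prop)
    simp only at ha hax hwT hw1 hwo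
    have hpos : 0 < ‖a - x‖ := by
      rw [norm_pos_iff, sub_ne_zero]
      rintro rfl
      have h0 : inner ℝ w w = 0 := Submodule.inner_right_of_mem_orthogonal hwT hwo
      rw [real_inner_self_eq_norm_sq, hw1] at h0
      norm_num at h0
    have hA : ∀ b ∈ S, ‖b - x‖ ≤ ‖a - x‖ / 2 → ∀ w ∈ tangentSpaceAt S x,
        w ∈ (tangentSpaceAt S b)ᗮ → w = 0 := by
      intro b hb hbx v hv hvo
      by_contra hv0
      have h1 := isMinOn_iff.1 hmin _ (hmemZ b hb (by linarith) v hv hvo hv0)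
      dsimp only at h1
      linarith
    have hR2 : 0 < ‖a - x‖ / 2 := by linarith
    have hR3 : ‖a - x‖ / 2 ≤ τ / 8 := by linarith
    have h1 := norm_sub_starProjection_le_of_surj hR2 hτ hx ha (by linarith) hQ
      (fun t ht htR => exists_starProjection_eq hS hR2 hR3 hx (hQ x hx) hA ht htR) hwT
    rw [(tangentSpaceAt S a).starProjection_apply_eq_zero_iff.2 hwo, sub_zero, hw1] at h1
    have h2 : 21 * (‖a - x‖ / 2) / τ ≤ 21 / 80 := by
      rw [div_le_div_iff₀ hτ (by norm_num)]
      linarith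
    linarith
  intro a ha hax w hw hwo
  by_contra hw0
  exact hempty ⟨_, hmemZ a ha hax w hw hwo hw0⟩

/-- The projection of `S` to its tangent space at `x` covers the ball of radius `R / 3`, already
from within the ball of radius `R ≤ τ / 40` about `x`. -/
theorem exists_mem_starProjection_eq {D k d : ℕ} {S : Set (RD D)}
    (hS : IsCompact S) (hk : 1 ≤ k) (hM : IsSubmanifold k d S) {τ : ℝ} (hτ : 0 < τ)
    (hQ : ∀ x ∈ S, ∀ b ∈ S, ‖(b - x) - (tangentSpaceAt S x).starProjection (b - x)‖
      ≤ ‖b - x‖ ^ 2 / (2 * τ)) {x : RD D} (hx : x ∈ S) {R : ℝ} (hR : 0 < R) (hRτ : R ≤ τ / 40)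
    {t : RD D} (ht : t ∈ tangentSpaceAt S x) (htR : ‖t‖ ≤ R / 3) :
    ∃ a ∈ S, ‖a - x‖ ≤ R ∧ (tangentSpaceAt S x).starProjection (a - x) = t :=
  exists_starProjection_eq hS hR (by linarith) hx (hQ x hx)
    (fun a ha hax => eq_zero_of_mem_tangentSpaceAt_of_mem_orthogonal hS hk hM hτ hQ hx a ha
      (hax.trans hRτ)) ht htR

/-- Tangent spaces at points at distance at most `2 R` differ by `O(R / τ)`. -/
theorem norm_sub_starProjection_tangentSpaceAt_le_mul {D k d : ℕ} {S : Set (RD D)}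
    (hS : IsCompact S) (hk : 1 ≤ k) (hM : IsSubmanifold k d S) {τ : ℝ} (hτ : 0 < τ)
    (hQ : ∀ x ∈ S, ∀ b ∈ S, ‖(b - x) - (tangentSpaceAt S x).starProjection (b - x)‖
      ≤ ‖b - x‖ ^ 2 / (2 * τ)) {x y : RD D} (hx : x ∈ S) (hy : y ∈ S) {R : ℝ} (hR : 0 < R)
    (hRτ : R ≤ τ / 40) (hxy : ‖y - x‖ ≤ 2 * R) {w : RD D} (hw : w ∈ tangentSpaceAt S x) :
    ‖w - (tangentSpaceAt S y).starProjection w‖ ≤ 21 * R / τ * ‖w‖ :=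
  norm_sub_starProjection_le_of_surj hR hτ hx hy hxy hQ
    (fun _ ht htR => exists_mem_starProjection_eq hS hk hM hτ hQ hx hR hRτ ht htR) hw

/-! ### Volumes of pieces of the tube -/

/-- Fubini's theorem along a subspace and its orthogonal complement, with origin `p`. -/
theorem measurePreserving_add_orthogonal {D : ℕ} (T : Submodule ℝ (RD D)) (p : RD D) :
    MeasurePreserving (fun q : T × Tᗮ => p + ((q.1 : RD D) + (q.2 : RD D)))
      (volume.prod volume) volume := by
  have h1 : MeasurePreserving (WithLp.toLp 2 : T × Tᗮ → WithLp 2 (T × Tᗮ)) :=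
    WithLp.volume_preserving_toLp T Tᗮ
  have h2 := T.orthogonalDecomposition.symm.measurePreserving.comp h1
  have h3 := (measurePreserving_add_left (volume : Measure (RD D)) p).comp h2
  convert h3 using 1
  · ext q
    simp
  · rfl

theorem volume_le_of_forall_norm_lt {D : ℕ} (T : Submodule ℝ (RD D)) (p : RD D) {A : Set (RD D)}
    (hA : MeasurableSet A) {a b : ℝ} (h1 : ∀ x ∈ A, ‖T.starProjection (x - p)‖ < a)
    (h2 : ∀ x ∈ A, ‖(x - p) - T.starProjection (x - p)‖ < b) :
    volume A ≤ volume (Metric.ball (0 : T) a) * volume (Metric.ball (0 : Tᗮ) b) := by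
  rw [← (measurePreserving_add_orthogonal T p).measure_preimage hA.nullMeasurableSet,
    ← Measure.prod_prod]
  refine measure_mono fun q hq => ?_
  have e1 : T.starProjection (p + ((q.1 : RD D) + (q.2 : RD D)) - p) = q.1 := by
    rw [add_sub_cancel_left, map_add, T.starProjection_eq_self_iff.2 q.1.2,
      T.starProjection_apply_eq_zero_iff.2 q.2.2, add_zero]
  have h3 := h1 _ hq
  have h4 := h2 _ hq
  rw [e1] at h3 h4
  rw [add_sub_cancel_left, add_sub_cancel_left] at h4
  exact ⟨by simpa using h3, by simpa using h4⟩

theorem le_volume_of_forall_fiber {D : ℕ} (T : Submodule ℝ (RD D)) (p : RD D) {A : Set (RD D)}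
    (hA : MeasurableSet A) {a b : ℝ} (u₀ : T)
    (h : ∀ u : T, ‖u - u₀‖ < a → ∃ v₀ : Tᗮ, ∀ v : Tᗮ, ‖v - v₀‖ < b →
      p + ((u : RD D) + (v : RD D)) ∈ A) :
    volume (Metric.ball u₀ a) * volume (Metric.ball (0 : Tᗮ) b) ≤ volume A := by
  have hmp := measurePreserving_add_orthogonal T p
  rw [← hmp.measure_preimage hA.nullMeasurableSet, Measure.prod_apply (hmp.measurable hA), mul_comm,
    ← setLIntegral_const]
  refine le_trans (setLIntegral_mono' Metric.isOpen_ball.measurableSet fun u hu => ?_)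
    (setLIntegral_le_lintegral (Metric.ball u₀ a) _)
  obtain ⟨v₀, hv₀⟩ := h u (by simpa [dist_eq_norm] using hu)
  rw [← Measure.addHaar_ball_center _ v₀]
  refine measure_mono fun v hv => hv₀ v ?_
  rwa [Metric.mem_ball, dist_eq_norm] at hv

theorem ofReal_mul_volume_le_volume {D : ℕ} (T : Submodule ℝ (RD D)) (p : RD D) {A B : Set (RD D)}
    (hA : MeasurableSet A) (hB : MeasurableSet B) {a b α β : ℝ} (hα : 0 < α) (hβ : 0 < β)
    (hβ1 : β ≤ 1) (u₀ : T)
    (h1 : ∀ x ∈ A, ‖T.starProjection (x - p)‖ < a)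
    (h2 : ∀ x ∈ A, ‖(x - p) - T.starProjection (x - p)‖ < b)
    (h : ∀ u : T, ‖u - u₀‖ < α * a → ∃ v₀ : Tᗮ, ∀ v : Tᗮ, ‖v - v₀‖ < β * b →
      p + ((u : RD D) + (v : RD D)) ∈ B) :
    ENNReal.ofReal (α ^ Module.finrank ℝ T * β ^ D) * volume A ≤ volume B := by
  refine le_trans ?_ (le_volume_of_forall_fiber T p hB u₀ h)
  rw [Measure.addHaar_ball_mul_of_pos _ _ hα, Measure.addHaar_ball_mul_of_pos _ _ hβ]
  have hfin : Module.finrank ℝ Tᗮ ≤ D := by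
    simpa using Tᗮ.finrank_le
  calc ENNReal.ofReal (α ^ Module.finrank ℝ T * β ^ D) * volume A
      ≤ ENNReal.ofReal (α ^ Module.finrank ℝ T * β ^ Module.finrank ℝ Tᗮ)
          * (volume (Metric.ball (0 : T) a) * volume (Metric.ball (0 : Tᗮ) b)) := by
        refine mul_le_mul' (ENNReal.ofReal_le_ofReal ?_) (volume_le_of_forall_norm_lt T p hA h1 h2)
        exact mul_le_mul_of_nonneg_left (pow_le_pow_of_le_one hβ.le hβ1 hfin) (by positivity)
    _ = _ := by
        rw [ENNReal.ofReal_mul (by positivity)]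
        ring

/-- The points of the tube within `ρ` of `r` are close to the affine tangent space at `p`. -/
theorem norm_sub_starProjection_lt_of_mem_thickening {D : ℕ} {S : Set (RD D)}
    {T : Submodule ℝ (RD D)} {τ σ ρ : ℝ} (hτ : 0 < τ)
    (hρ2 : ρ ^ 2 = σ * τ) (hσρ : 2 * σ ≤ ρ) {p r x : RD D}
    (hQ : ∀ b ∈ S, ‖(b - p) - T.starProjection (b - p)‖ ≤ ‖b - p‖ ^ 2 / (2 * τ))
    (hr : ‖r - p‖ < σ) (hx : x ∈ Metric.thickening σ S) (hxr : dist x r < ρ) :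
    ‖(x - p) - T.starProjection (x - p)‖ < 3 * σ := by
  obtain ⟨b, hb, hxb⟩ := Metric.mem_thickening_iff.1 hx
  rw [dist_eq_norm] at hxb hxr
  have h1 : ‖b - p‖ ≤ 2 * ρ := by
    have e : b - p = (x - r) + (r - p) - (x - b) := by abel
    rw [e]
    refine (norm_sub_le _ _).trans ?_
    linarith [norm_add_le (x - r) (r - p)]
  have h2 : ‖b - p‖ ^ 2 / (2 * τ) ≤ 2 * σ := by
    rw [div_le_iff₀ (by positivity)]
    have : ‖b - p‖ ^ 2 ≤ (2 * ρ) ^ 2 := by gcongr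
    nlinarith
  have h3 := norm_sub_starProjection_sub_le T (b - p) (b - x)
  rw [sub_sub_sub_cancel_left] at h3
  have h4 := norm_sub_starProjection_le_norm T (b - x)
  rw [norm_sub_rev b x] at h4
  linarith [hQ b hb]

/-- A ball of radius comparable to `ρ = √(σ τ)`, centred at distance at most `ρ / 2` from `p` in a
tangent direction, captures a fixed proportion of the volume of the tube inside the region of
interest. -/
theorem ofReal_mul_volume_roi_le {D : ℕ} {S : Set (RD D)} {T : Submodule ℝ (RD D)}
    {τ σ ρ m : ℝ} (hσ : 0 < σ) (hτ : 0 < τ) (hρ : 0 < ρ) (hm : 1 ≤ m)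
    (hρ2 : ρ ^ 2 = σ * τ) (hσρ : 120 * m * σ ≤ ρ) {p r y : RD D}
    (hQ : ∀ b ∈ S, ‖(b - p) - T.starProjection (b - p)‖ ≤ ‖b - p‖ ^ 2 / (2 * τ))
    (hsurj : ∀ t ∈ T, ‖t‖ ≤ ρ → ∃ a ∈ S, ‖a - p‖ ≤ 3 * ρ ∧ T.starProjection (a - p) = t)
    (hr : ‖r - p‖ < σ) (hy : y ∈ T) (hy1 : ‖y‖ ≤ 1) :
    ENNReal.ofReal ((1 / (32 * m)) ^ Module.finrank ℝ T * (1 / 3) ^ D)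
        * volume (Metric.thickening σ S ∩ Metric.ball r ρ)
      ≤ volume (Metric.thickening σ S ∩ Metric.ball (p + (ρ / 2) • y) (ρ / (8 * m))) := by
  have hσρ2 : 120 * σ ≤ ρ := by nlinarith
  refine ofReal_mul_volume_le_volume T p (a := 2 * ρ) (b := 3 * σ)
    (Metric.isOpen_thickening.inter Metric.isOpen_ball).measurableSet
    (Metric.isOpen_thickening.inter Metric.isOpen_ball).measurableSet (by positivity)
    (by norm_num) (by norm_num) (⟨(ρ / 2) • y, T.smul_mem _ hy⟩ : T) ?_ ?_ ?_
  · rintro x ⟨-, hx⟩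
    rw [Metric.mem_ball, dist_eq_norm] at hx
    have h1 := T.norm_starProjection_apply_le (x - p)
    have h2 := norm_add_le (x - r) (r - p)
    rw [sub_add_sub_cancel] at h2
    linarith
  · rintro x ⟨hx1, hx2⟩
    exact norm_sub_starProjection_lt_of_mem_thickening hτ hρ2 (by linarith) hQ hr hx1 hx2
  · intro u hu
    have hu' : ‖(u : RD D) - (ρ / 2) • y‖ < ρ / (16 * m) := by
      have e : 1 / (32 * m) * (2 * ρ) = ρ / (16 * m) := by field_simp; ring
      rw [e] at hu
      simpa using hu
    have hm16 : ρ / (16 * m) ≤ ρ / 2 := by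
      apply div_le_div_of_nonneg_left hρ.le two_pos
      linarith
    have huρ : ‖(u : RD D)‖ ≤ ρ := by
      have h1 := norm_add_le ((u : RD D) - (ρ / 2) • y) ((ρ / 2) • y)
      rw [sub_add_cancel, norm_smul, Real.norm_of_nonneg (by positivity)] at h1
      nlinarith
    obtain ⟨a, haS, haR, hau⟩ := hsurj u u.2 huρ
    have hQa := hQ a haS
    rw [hau] at hQa
    have hv₀ : (a - p) - (u : RD D) ∈ Tᗮ := by
      rw [← hau]; exact T.sub_starProjection_mem_orthogonal _
    have hv₀n : ‖(a - p) - (u : RD D)‖ ≤ 9 / 2 * σ := by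
      refine hQa.trans ?_
      rw [div_le_iff₀ (by positivity)]
      have : ‖a - p‖ ^ 2 ≤ (3 * ρ) ^ 2 := by gcongr
      nlinarith
    refine ⟨⟨_, hv₀⟩, fun v hv => ?_⟩
    have hv' : ‖(v : RD D) - ((a - p) - (u : RD D))‖ < σ := by
      have e : 1 / 3 * (3 * σ) = σ := by ring
      rw [e] at hv
      simpa using hv
    constructor
    · refine Metric.mem_thickening_iff.2 ⟨a, haS, ?_⟩
      rw [dist_eq_norm]
      have e : p + ((u : RD D) + (v : RD D)) - a = (v : RD D) - ((a - p) - (u : RD D)) := by abel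
      rwa [e]
    · rw [Metric.mem_ball, dist_eq_norm]
      have e : p + ((u : RD D) + (v : RD D)) - (p + (ρ / 2) • y)
          = ((u : RD D) - (ρ / 2) • y) + ((v : RD D) - ((a - p) - (u : RD D)))
            + ((a - p) - (u : RD D)) := by abel
      have h1 := norm_add₃_le (a := (u : RD D) - (ρ / 2) • y)
        (b := (v : RD D) - ((a - p) - (u : RD D))) (c := (a - p) - (u : RD D))
      rw [← e] at h1
      have h2 : ρ / (8 * m) = ρ / (16 * m) + ρ / (16 * m) := by field_simp; ring
      have h3 : 11 / 2 * σ ≤ ρ / (16 * m) := by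
        rw [le_div_iff₀ (by positivity)]
        nlinarith
      linarith

/-! ### A weak law of large numbers -/

/-- By Chebyshev's inequality, a sum of many independent copies of a bounded variable of positive
mean is positive with high probability. -/
theorem exists_forall_measure_pi_sum_nonpos_le {X : Type*} [MeasurableSpace X] (μ : Measure X)
    [IsProbabilityMeasure μ] {f : X → ℝ} (hf : Measurable f) {B : ℝ} (hB : ∀ x, |f x| ≤ B)
    (hpos : 0 < ∫ x, f x ∂μ) {δ : ℝ} (hδ : 0 < δ) :
    ∃ N : ℕ, ∀ n : ℕ, N < n →
      Measure.pi (fun _ : Fin n => μ) {x | ∑ i, f (x i) ≤ 0} ≤ ENNReal.ofReal δ := by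
  set m := ∫ x, f x ∂μ with hm
  have hL2 : MemLp f 2 μ :=
    MemLp.of_bound hf.aestronglyMeasurable B (Filter.Eventually.of_forall hB)
  have hint : Integrable f μ := hL2.integrable one_le_two
  set v := ProbabilityTheory.variance f μ with hv
  obtain ⟨N, hN⟩ := exists_nat_gt (v / (δ * m ^ 2))
  refine ⟨N, fun n hn => ?_⟩
  have hn0 : (0 : ℝ) < n := by exact_mod_cast (Nat.zero_le N).trans_lt hn
  set P := Measure.pi (fun _ : Fin n => μ) with hP
  set Y : (Fin n → X) → ℝ := ∑ i : Fin n, fun x : Fin n → X => f (x i) with hY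
  have hYL2 : MemLp Y 2 P := by
    rw [hY]
    refine memLp_finsetSum' _ fun i _ => ?_
    exact hL2.comp_measurePreserving (measurePreserving_eval (fun _ : Fin n => μ) i)
  have hvar : ProbabilityTheory.variance Y P = n * v := by
    rw [hY, hP, ProbabilityTheory.variance_sum_pi (fun _ => hL2)]
    simp [hv]
  have hmean : ∫ x, Y x ∂P = n * m := by
    have h1 : ∀ i : Fin n, ∫ x, f (x i) ∂P = m := fun i =>
      integral_comp_eval (μ := fun _ : Fin n => μ) hf.aestronglyMeasurable
    have h2 : ∀ i : Fin n, Integrable (fun x : Fin n → X => f (x i)) P := fun i =>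
      (measurePreserving_eval (fun _ : Fin n => μ) i).integrable_comp_of_integrable hint
    simp only [hY, Finset.sum_apply]
    rw [integral_finsetSum _ fun i _ => h2 i]
    simp [h1]
  have hcheb := ProbabilityTheory.meas_ge_le_variance_div_sq hYL2 (c := n * m) (by positivity)
  rw [hvar, hmean] at hcheb
  refine (measure_mono fun x hx => ?_).trans (hcheb.trans (ENNReal.ofReal_le_ofReal ?_))
  · have hx' : Y x ≤ 0 := by simpa [hY] using hx
    show n * m ≤ |Y x - n * m|
    rw [abs_sub_comm]
    exact le_trans (by linarith) (le_abs_self _)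
  · have hNn : (N : ℝ) ≤ n := by exact_mod_cast hn.le
    have h2 : v / (δ * m ^ 2) < n := hN.trans_le hNn
    rw [div_lt_iff₀ (by positivity)] at h2
    rw [div_le_iff₀ (by positivity)]
    nlinarith

/-- The version of the law for finitely many variables at once, on samples from a set of full
measure. -/
theorem exists_forall_exists_measurableSet_pi {X ι : Type*} [MeasurableSpace X] [Fintype ι]
    (μ : Measure X) [IsProbabilityMeasure μ] {A : Set X} (hA : MeasurableSet A) (hA1 : μ A = 1)
    {f : ι → X → ℝ} (hf : ∀ j, Measurable (f j)) {B : ℝ} (hB : ∀ j x, |f j x| ≤ B)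
    (hpos : ∀ j, 0 < ∫ x, f j x ∂μ) {δ : ℝ} (hδ : 0 < δ) :
    ∃ N : ℕ, ∀ n : ℕ, N < n → ∃ E : Set (Fin n → X), MeasurableSet E ∧
      ENNReal.ofReal (1 - δ) ≤ Measure.pi (fun _ : Fin n => μ) E ∧
      ∀ x ∈ E, (∀ i, x i ∈ A) ∧ ∀ j, 0 < ∑ i, f j (x i) := by
  set c : ℝ := Fintype.card ι + 1 with hc
  have hc0 : 0 < c := by positivity
  choose N hN using fun j => exists_forall_measure_pi_sum_nonpos_le μ (hf j) (hB j) (hpos j)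
    (div_pos hδ hc0)
  refine ⟨∑ j, N j, fun n hn => ?_⟩
  set P := Measure.pi (fun _ : Fin n => μ) with hP
  set F : Set (Fin n → X) := ⋃ j, {x | ∑ i, f j (x i) ≤ 0} with hF
  have hFm : MeasurableSet F := by
    refine MeasurableSet.iUnion fun j => measurableSet_le ?_ measurable_const
    exact Finset.measurable_fun_sum _ fun i _ => (hf j).comp (measurable_pi_apply i)
  have hFle : P F ≤ ENNReal.ofReal δ := by
    refine (measure_iUnion_fintype_le P _).trans ?_
    refine (Finset.sum_le_sum fun j _ => hN j n
      ((Finset.single_le_sum (fun _ _ => Nat.zero_le _) (Finset.mem_univ j)).trans_lt hn)).trans ?_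
    rw [Finset.sum_const, nsmul_eq_mul, Finset.card_univ, ← ENNReal.ofReal_natCast,
      ← ENNReal.ofReal_mul (by positivity)]
    refine ENNReal.ofReal_le_ofReal ?_
    rw [← mul_div_assoc, div_le_iff₀ hc0]
    nlinarith
  set G : Set (Fin n → X) := Set.univ.pi fun _ => A with hG
  have hGm : MeasurableSet G := MeasurableSet.univ_pi fun _ => hA
  have hG1 : P G = 1 := by
    rw [hG, hP, Measure.pi_pi]; simp [hA1]
  refine ⟨G \ F, hGm.diff hFm, ?_, ?_⟩
  · have h1 := le_measure_sdiff (μ := P) (s₁ := G) (s₂ := F)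
    rw [hG1] at h1
    refine le_trans ?_ h1
    rw [ENNReal.ofReal_sub _ hδ.le, ENNReal.ofReal_one]
    exact tsub_le_tsub_left hFle 1
  · rintro x ⟨hxG, hxF⟩
    refine ⟨fun i => hxG i (Set.mem_univ i), fun j => ?_⟩
    by_contra! hcon
    exact hxF (Set.mem_iUnion.2 ⟨j, hcon⟩)

/-! ### From sample residuals to the angle -/

theorem J1_le_of_forall_infDist_le {D n : ℕ} {ρ c : ℝ} {r q : RD D} {x : Fin n → RD D}
    {H : Submodule ℝ (RD D)}
    (h : ∀ i ∈ roi ρ r x, Metric.infDist (x i - q) (H : Set (RD D)) ≤ c) :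
    J1 ρ r x q H ≤ c ^ 2 := by
  unfold J1
  rcases (roi ρ r x).eq_empty_or_nonempty with h0 | hne
  · rw [h0]; simp; positivity
  · have hN : (0 : ℝ) < (roi ρ r x).card := by exact_mod_cast hne.card_pos
    rw [one_div, inv_mul_le_iff₀ hN]
    refine (Finset.sum_le_sum fun i hi => ?_).trans (by rw [Finset.sum_const, nsmul_eq_mul])
    have := h i hi
    have h1 : 0 ≤ Metric.infDist (x i - q) (H : Set (RD D)) := Metric.infDist_nonneg
    gcongr

/-- Markov's inequality for samples: if `Q` contains more than the proportion `κ` of the samples in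
the region of interest and the mean squared residual is at most `c ^ 2`, then a sample in `Q` has
residual at most `c / √κ`. -/
theorem exists_infDist_le_of_J1_le {D n : ℕ} {ρ c κ : ℝ} {r q : RD D} {x : Fin n → RD D}
    {H : Submodule ℝ (RD D)} (hc : 0 < c) (hκ : 0 < κ) (hJ : J1 ρ r x q H ≤ c ^ 2)
    {Q : Set (RD D)} (hQ : Q ⊆ Metric.ball r ρ)
    (hpos : 0 < ∑ i, (Q.indicator (fun _ => (1 : ℝ)) (x i)
      - κ * (Metric.ball r ρ).indicator (fun _ => (1 : ℝ)) (x i))) :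
    ∃ i, x i ∈ Q ∧ Metric.infDist (x i - q) (H : Set (RD D)) ≤ c / √κ := by
  by_contra! hcon
  have hsum : ∀ g : Fin n → ℝ, ∑ i, (Metric.ball r ρ).indicator (fun _ => (1 : ℝ)) (x i) * g i
      = ∑ i ∈ roi ρ r x, g i := by
    intro g
    rw [roi, Finset.sum_filter]
    refine Finset.sum_congr rfl fun i _ => ?_
    by_cases hi : dist (x i) r < ρ <;> simp [Set.indicator, hi]
  set N : ℝ := ((roi ρ r x).card : ℝ) with hN
  have hNeq : ∑ i, (Metric.ball r ρ).indicator (fun _ => (1 : ℝ)) (x i) = N := by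
    have := hsum fun _ => 1
    simpa using this
  rw [Finset.sum_sub_distrib, ← Finset.mul_sum, hNeq] at hpos
  have hNc : ∑ i ∈ roi ρ r x, Metric.infDist (x i - q) (H : Set (RD D)) ^ 2 ≤ N * c ^ 2 := by
    rcases (Nat.cast_nonneg (roi ρ r x).card : (0 : ℝ) ≤ _).eq_or_lt with h0 | h0
    · have h1 : (roi ρ r x) = ∅ := by
        rw [← Finset.card_eq_zero]; exact_mod_cast h0.symm
      rw [h1, Finset.sum_empty]; positivity
    · unfold J1 at hJ
      rwa [one_div, inv_mul_le_iff₀ h0] at hJ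
  have hterm : ∀ i, Q.indicator (fun _ => (1 : ℝ)) (x i) * (c ^ 2 / κ)
      ≤ (Metric.ball r ρ).indicator (fun _ => (1 : ℝ)) (x i)
        * Metric.infDist (x i - q) (H : Set (RD D)) ^ 2 := by
    intro i
    by_cases hi : x i ∈ Q
    · rw [Set.indicator_of_mem hi, Set.indicator_of_mem (hQ hi), one_mul, one_mul]
      have h1 := hcon i hi
      have h2 : c ^ 2 / κ = (c / √κ) ^ 2 := by rw [div_pow, Real.sq_sqrt hκ.le]
      rw [h2]
      gcongr
    · rw [Set.indicator_of_notMem hi, zero_mul]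
      exact mul_nonneg (Set.indicator_nonneg (fun _ _ => zero_le_one) _) (sq_nonneg _)
  have h3 := Finset.sum_le_sum fun i (_ : i ∈ Finset.univ) => hterm i
  rw [hsum, ← Finset.sum_mul] at h3
  have h4 := h3.trans hNc
  rw [← mul_div_assoc, div_le_iff₀ hκ] at h4
  have hc2 : 0 < c ^ 2 := by positivity
  nlinarith

/-- A self-improving estimate: a bound on an orthonormal basis which is allowed to use a small
multiple of the bound `s` sought for the whole of `T`. -/
theorem norm_sub_starProjection_le_of_orthonormalBasis {D d : ℕ} {T H : Submodule ℝ (RD D)}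
    (b : OrthonormalBasis (Fin d) ℝ T) {η : ℝ}
    (h : ∀ s, 0 ≤ s → (∀ w ∈ T, ‖w - H.starProjection w‖ ≤ s * ‖w‖) →
      ∀ i, ‖(b i : RD D) - H.starProjection (b i)‖ ≤ s / (2 * (d + 1)) + η) :
    ∀ w ∈ T, ‖w - H.starProjection w‖ ≤ 2 * d * η * ‖w‖ := by
  let L : T →L[ℝ] RD D := (ContinuousLinearMap.id ℝ (RD D) - H.starProjection).comp T.subtypeL
  have hL : ∀ w : T, L w = (w : RD D) - H.starProjection w := fun w => rfl
  have hLs : ∀ w ∈ T, ‖w - H.starProjection w‖ ≤ ‖L‖ * ‖w‖ := fun w hw =>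
    L.le_opNorm ⟨w, hw⟩
  have hb := h ‖L‖ L.opNorm_nonneg hLs
  have h1 : ‖L‖ ≤ ∑ i, ‖L (b i)‖ := by
    refine L.opNorm_le_bound (Finset.sum_nonneg fun _ _ => norm_nonneg _) fun w => ?_
    conv_lhs => rw [← b.sum_repr' w, map_sum]
    rw [Finset.sum_mul]
    refine (norm_sum_le _ _).trans (Finset.sum_le_sum fun i _ => ?_)
    rw [map_smul, norm_smul, mul_comm]
    refine mul_le_mul_of_nonneg_left ?_ (norm_nonneg _)
    have := norm_inner_le_norm (𝕜 := ℝ) (b i) w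
    rwa [b.norm_eq_one, one_mul] at this
  have h2 : ‖L‖ ≤ d * (‖L‖ / (2 * (d + 1)) + η) := by
    refine h1.trans ((Finset.sum_le_sum fun i _ => (hL (b i) ▸ hb i)).trans ?_)
    simp [mul_add]
  have h3 : (d : ℝ) * (‖L‖ / (2 * (d + 1))) ≤ ‖L‖ / 2 := by
    rw [← mul_div_assoc, div_le_div_iff₀ (by positivity) two_pos]
    nlinarith [L.opNorm_nonneg]
  intro w hw
  refine (hLs w hw).trans (mul_le_mul_of_nonneg_right ?_ (norm_nonneg _))
  linarith

/-- If `x₀` and, for each basis direction of `T`, a point `x i` near `p + (ρ / 2) • b i` are within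
`3 σ` of `p + T` and within `ε` of a translate of `H`, then `T` is within `O((σ + ε) / ρ)` of `H`. -/
theorem norm_sub_starProjection_le_of_samples {D d : ℕ} {T H : Submodule ℝ (RD D)}
    (b : OrthonormalBasis (Fin d) ℝ T) {ρ σ ε : ℝ} (hρ : 0 < ρ) {p q x₀ : RD D}
    {x : Fin d → RD D}
    (hx₀ : ‖x₀ - p‖ ≤ ρ / (8 * (d + 1)))
    (hx : ∀ i, ‖x i - (p + (ρ / 2) • (b i : RD D))‖ ≤ ρ / (8 * (d + 1)))
    (hT₀ : ‖(x₀ - p) - T.starProjection (x₀ - p)‖ ≤ 3 * σ)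
    (hT : ∀ i, ‖(x i - p) - T.starProjection (x i - p)‖ ≤ 3 * σ)
    (hH₀ : ‖(x₀ - q) - H.starProjection (x₀ - q)‖ ≤ ε)
    (hH : ∀ i, ‖(x i - q) - H.starProjection (x i - q)‖ ≤ ε) :
    ∀ w ∈ T, ‖w - H.starProjection w‖ ≤ 2 * d * (4 * (3 * σ + ε) / ρ) * ‖w‖ := by
  refine norm_sub_starProjection_le_of_orthonormalBasis b fun s hs hsT i => ?_
  set e : RD D := ((b i : T) : RD D) with he
  set y := (x i - x₀) - (ρ / 2) • e with hy
  have hyn : ‖y‖ ≤ ρ / (4 * (d + 1)) := by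
    have e1 : y = (x i - (p + (ρ / 2) • e)) - (x₀ - p) := by rw [hy]; abel
    have e2 : ρ / (4 * ((d : ℝ) + 1)) = ρ / (8 * (d + 1)) + ρ / (8 * (d + 1)) := by
      field_simp; ring
    rw [e1, e2]
    exact (norm_sub_le _ _).trans (add_le_add (hx i) hx₀)
  have hyT : ‖y - T.starProjection y‖ ≤ 6 * σ := by
    have e1 : y = ((x i - p) - (x₀ - p)) - (ρ / 2) • e := by rw [hy]; abel
    have h1 := norm_sub_starProjection_sub_le T ((x i - p) - (x₀ - p)) ((ρ / 2) • e)
    rw [← e1, T.starProjection_eq_self_iff.2 (T.smul_mem _ (b i).2), sub_self, norm_zero,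
      add_zero] at h1
    have h2 := norm_sub_starProjection_sub_le T (x i - p) (x₀ - p)
    linarith [hT i]
  have hyH : ‖y - H.starProjection y‖ ≤ s * (ρ / (4 * (d + 1))) + 6 * σ := by
    have h1 := norm_sub_starProjection_sub_le H y (y - T.starProjection y)
    have h2 := norm_sub_starProjection_le_norm H (y - T.starProjection y)
    have h3 : ‖T.starProjection y - H.starProjection (T.starProjection y)‖
        ≤ s * (ρ / (4 * (d + 1))) := by
      refine (hsT _ (T.starProjection_apply_mem y)).trans (mul_le_mul_of_nonneg_left ?_ hs)
      exact (T.norm_starProjection_apply_le y).trans hyn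
    have e1 : y = T.starProjection y - (-(y - T.starProjection y)) := by abel
    have h4 := norm_sub_starProjection_sub_le H (T.starProjection y) (-(y - T.starProjection y))
    rw [← e1] at h4
    have h5 := norm_sub_starProjection_le_norm H (-(y - T.starProjection y))
    rw [norm_neg] at h5
    linarith
  have h6 : ‖(ρ / 2) • e - H.starProjection ((ρ / 2) • e)‖
      ≤ (ε + ε) + (s * (ρ / (4 * (d + 1))) + 6 * σ) := by
    have e1 : (ρ / 2) • e = ((x i - q) - (x₀ - q)) - y := by rw [hy]; abel
    have h1 := norm_sub_starProjection_sub_le H ((x i - q) - (x₀ - q)) y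
    rw [← e1] at h1
    have h2 := norm_sub_starProjection_sub_le H (x i - q) (x₀ - q)
    linarith [hH i]
  rw [norm_sub_starProjection_smul, abs_of_pos (by positivity)] at h6
  have e3 : s / (2 * ((d : ℝ) + 1)) + 4 * (3 * σ + ε) / ρ
      = 2 / ρ * ((ε + ε) + (s * (ρ / (4 * (d + 1))) + 6 * σ)) := by
    field_simp; ring
  have e4 : ‖e - H.starProjection e‖ = 2 / ρ * (ρ / 2 * ‖e - H.starProjection e‖) := by
    field_simp
  rw [e3, e4]
  exact mul_le_mul_of_nonneg_left h6 (by positivity)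

theorem norm_sub_lt_of_isNearestPoint_of_mem_thickening {D : ℕ} {S : Set (RD D)} {σ : ℝ}
    {r p : RD D} (hp : IsNearestPoint S r p) (hr : r ∈ Metric.thickening σ S) : ‖r - p‖ < σ := by
  obtain ⟨a, ha, hra⟩ := Metric.mem_thickening_iff.1 hr
  rw [← dist_eq_norm]
  exact (hp.2 a ha).trans_lt hra

theorem norm_sub_le_three_mul {D d : ℕ} {S : Set (RD D)} {σ : ℝ} {r p₀ p q : RD D}
    {H : Submodule ℝ (RD D)} (hp₀ : p₀ ∈ S) (hr : ‖r - p₀‖ < σ) (hq : IsFeasible d σ r q H)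
    (hp : IsNearestPoint S q p) : ‖p - q‖ ≤ 3 * σ := by
  have h1 := hp.2 p₀ hp₀
  rw [dist_eq_norm, dist_eq_norm, norm_sub_rev q p] at h1
  have h2 := norm_sub_le (r - p₀) (r - q)
  rw [sub_sub_sub_cancel_left] at h2
  linarith [hq.2.2]

theorem isProbabilityMeasure_tubeUniform {D : ℕ} {S : Set (RD D)} (hS : IsCompact S)
    (hne : S.Nonempty) {σ : ℝ} (hσ : 0 < σ) : IsProbabilityMeasure (tubeUniform S σ) := by
  refine ProbabilityTheory.cond_isProbabilityMeasure_of_finite ?_ ?_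
  · exact (Metric.isOpen_thickening.measure_pos _
      (hne.mono (Metric.self_subset_thickening hσ S))).ne'
  · exact (hS.isBounded.thickening.measure_lt_top).ne

theorem tubeUniform_self {D : ℕ} {S : Set (RD D)} (hS : IsCompact S)
    (hne : S.Nonempty) {σ : ℝ} (hσ : 0 < σ) : tubeUniform S σ (Metric.thickening σ S) = 1 := by
  refine ProbabilityTheory.cond_apply_self ?_ ?_
  · exact (Metric.isOpen_thickening.measure_pos _
      (hne.mono (Metric.self_subset_thickening hσ S))).ne'
  · exact (hS.isBounded.thickening.measure_lt_top).ne

/-- A comparison of volumes inside the tube, as positivity of the mean of a test function. -/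
theorem integral_indicator_sub_pos {D : ℕ} {S : Set (RD D)} (hS : IsCompact S) {σ ρ κ : ℝ}
    (hσ : 0 < σ) (hρ : 0 < ρ) (hκ : 0 < κ) {r : RD D} (hr : r ∈ Metric.thickening σ S)
    {Q : Set (RD D)} (hQ : MeasurableSet Q)
    (hvol : ENNReal.ofReal (2 * κ) * volume (Metric.thickening σ S ∩ Metric.ball r ρ)
      ≤ volume (Metric.thickening σ S ∩ Q)) :
    0 < ∫ x, (Q.indicator (fun _ => (1 : ℝ)) x
      - κ * (Metric.ball r ρ).indicator (fun _ => (1 : ℝ)) x) ∂(tubeUniform S σ) := by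
  have hne : S.Nonempty := by
    obtain ⟨a, ha, -⟩ := Metric.mem_thickening_iff.1 hr
    exact ⟨a, ha⟩
  have hprob := isProbabilityMeasure_tubeUniform hS hne hσ
  have hmt : MeasurableSet (Metric.thickening σ S) := Metric.isOpen_thickening.measurableSet
  have hmb : MeasurableSet (Metric.ball r ρ) := Metric.isOpen_ball.measurableSet
  have hfin : volume (Metric.thickening σ S) ≠ ⊤ := (hS.isBounded.thickening.measure_lt_top).ne
  have hpos : 0 < (tubeUniform S σ).real (Metric.ball r ρ) := by
    refine ENNReal.toReal_pos ?_ (measure_ne_top _ _)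
    rw [tubeUniform, ProbabilityTheory.cond_apply hmt]
    refine mul_ne_zero (ENNReal.inv_ne_zero.2 hfin) ?_
    exact ((Metric.isOpen_thickening.inter Metric.isOpen_ball).measure_pos _
      ⟨r, hr, Metric.mem_ball_self hρ⟩).ne'
  have hle : 2 * κ * (tubeUniform S σ).real (Metric.ball r ρ) ≤ (tubeUniform S σ).real Q := by
    have h1 : ENNReal.ofReal (2 * κ) * tubeUniform S σ (Metric.ball r ρ) ≤ tubeUniform S σ Q := by
      rw [tubeUniform, ProbabilityTheory.cond_apply hmt, ProbabilityTheory.cond_apply hmt,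
        mul_left_comm]
      exact mul_le_mul_right hvol _
    have h2 := ENNReal.toReal_mono (measure_ne_top _ _) h1
    rwa [ENNReal.toReal_mul, ENNReal.toReal_ofReal (by positivity)] at h2
  have i1 : Integrable (Q.indicator (fun _ => (1 : ℝ))) (tubeUniform S σ) :=
    (integrable_const 1).indicator hQ
  have i2 : Integrable ((Metric.ball r ρ).indicator (fun _ => (1 : ℝ))) (tubeUniform S σ) :=
    (integrable_const 1).indicator hmb
  rw [integral_sub i1 (i2.const_mul κ), integral_const_mul, integral_indicator_const _ hQ,
    integral_indicator_const _ hmb, smul_eq_mul, smul_eq_mul, mul_one, mul_one]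
  nlinarith

/-! ### The angle between a minimizer and the tangent space -/

/-- If the tangent space at `p₀` is within `s` of a subspace `H` of the same dimension, then `H` is
within `2 (s + O(R / τ))` of the tangent space at any `p` with `‖p - p₀‖ ≤ 2 R`. -/
theorem norm_sub_starProjection_tangentSpaceAt_le_of_near {D k d : ℕ} {S : Set (RD D)}
    (hS : IsCompact S) (hk : 1 ≤ k) (hM : IsSubmanifold k d S) {τ R s : ℝ} (hτ : 0 < τ)
    (hQ : ∀ x ∈ S, ∀ b ∈ S, ‖(b - x) - (tangentSpaceAt S x).starProjection (b - x)‖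
      ≤ ‖b - x‖ ^ 2 / (2 * τ)) {p₀ p : RD D} (hp₀ : p₀ ∈ S) (hp : p ∈ S) (hR : 0 < R)
    (hRτ : R ≤ τ / 40) (hpp₀ : ‖p - p₀‖ ≤ 2 * R) (hs0 : 0 ≤ s) (hs : s ≤ 1 / 2)
    {H : Submodule ℝ (RD D)} (hH : Module.finrank ℝ H = d)
    (hnear : ∀ w ∈ tangentSpaceAt S p₀, ‖w - H.starProjection w‖ ≤ s * ‖w‖)
    {u : RD D} (hu : u ∈ H) :
    ‖u - (tangentSpaceAt S p).starProjection u‖ ≤ 2 * (s + 21 * R / τ) * ‖u‖ := by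
  obtain ⟨w, hwT, hw2, huw⟩ := exists_mem_near_of_forall_near hs
    (hH.trans (hM.finrank_tangentSpaceAt hk hp₀).symm) hnear hu
  have h1 := norm_sub_starProjection_tangentSpaceAt_le_mul hS hk hM hτ hQ hp₀ hp hR hRτ hpp₀ hwT
  set T := tangentSpaceAt S p
  have h2 := norm_sub_starProjection_le T u (T.starProjection_apply_mem w)
  have h3 : ‖u - T.starProjection w‖ ≤ ‖u - w‖ + ‖w - T.starProjection w‖ := by
    simpa using norm_add_le (u - w) (w - T.starProjection w)
  calc ‖u - T.starProjection u‖ ≤ (s + 21 * R / τ) * ‖w‖ := by linarith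
    _ ≤ (s + 21 * R / τ) * (2 * ‖u‖) := by gcongr
    _ = 2 * (s + 21 * R / τ) * ‖u‖ := by ring

/-- The deterministic part of the angle bound: it holds as soon as the samples lie in the tube and
each test ball receives its share `κ` of the samples in the region of interest. -/
theorem maxPrincipalAngle_le_of_samples {D k d n : ℕ} {S : Set (RD D)} (hS : IsCompact S)
    (hk : 1 ≤ k) (hM : IsSubmanifold k d S) {τ σ κ : ℝ} (hσ : 0 < σ) (hτ : 0 < τ)
    (hQ : ∀ x ∈ S, ∀ b ∈ S, ‖(b - x) - (tangentSpaceAt S x).starProjection (b - x)‖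
      ≤ ‖b - x‖ ^ 2 / (2 * τ))
    (hκ : 0 < κ) (hκ1 : κ ≤ 1) (hbig : 120 * (d + 1) / √κ ≤ √(τ / σ)) {r p₀ : RD D}
    (hr : ‖r - p₀‖ < σ) (hp₀ : IsNearestPoint S r p₀)
    (b : OrthonormalBasis (Fin d) ℝ (tangentSpaceAt S p₀)) {x : Fin n → RD D}
    (hx : ∀ i, x i ∈ Metric.thickening σ S)
    (hshare : ∀ y : RD D, (y = 0 ∨ ∃ j, y = b j) →
      0 < ∑ i, ((Metric.ball (p₀ + (√(σ * τ) / 2) • y)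
            (√(σ * τ) / (8 * (d + 1)))).indicator (fun _ => (1 : ℝ)) (x i)
          - κ * (Metric.ball r √(σ * τ)).indicator (fun _ => (1 : ℝ)) (x i)))
    {q p : RD D} {H : Submodule ℝ (RD D)} (hout : IsStep1Output d σ τ r x q H)
    (hp : IsNearestPoint S q p) :
    maxPrincipalAngle H (tangentSpaceAt S p)
      ≤ √((2 * (24 * d * (4 / √κ) + 126)) ^ 2 / (τ / σ)) := by
  set ρ := √(σ * τ) with hρdef
  set M := √(τ / σ) with hMdef
  have hρ : 0 < ρ := Real.sqrt_pos.2 (by positivity)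
  have hMpos : 0 < M := Real.sqrt_pos.2 (by positivity)
  have hM2 : M ^ 2 = τ / σ := Real.sq_sqrt (by positivity)
  have hτM : τ = σ * M ^ 2 := by rw [hM2]; field_simp
  have hρ2 : ρ ^ 2 = σ * τ := Real.sq_sqrt (by positivity)
  have hρM : ρ = σ * M := by
    rw [hρdef, hτM, show σ * (σ * M ^ 2) = (σ * M) ^ 2 by ring, Real.sqrt_sq (by positivity)]
  have hsκ : 0 < √κ := Real.sqrt_pos.2 hκ
  have hsκ1 : √κ ≤ 1 := Real.sqrt_le_one.2 hκ1
  have hbig' : 120 * ((d : ℝ) + 1) ≤ M * √κ := by rwa [div_le_iff₀ hsκ] at hbig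
  have hM120 : 120 * ((d : ℝ) + 1) ≤ M := by nlinarith
  have hd0 : (0 : ℝ) ≤ d := by positivity
  have hM120' : 120 ≤ M := by linarith
  have hσρ : 120 * σ ≤ ρ := by rw [hρM]; nlinarith
  -- a sample in the region of interest is within `3 σ` of the affine tangent space at `p₀`
  have hslab : ∀ i, dist (x i) r < ρ →
      ‖(x i - p₀) - (tangentSpaceAt S p₀).starProjection (x i - p₀)‖ < 3 * σ :=
    fun i hi => norm_sub_starProjection_lt_of_mem_thickening hτ hρ2 (by linarith)
      (hQ p₀ hp₀.1) hr (hx i) hi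
  have hJ : J1 ρ r x q H ≤ (3 * σ) ^ 2 := by
    refine (hout.2 p₀ (tangentSpaceAt S p₀) ⟨hM.finrank_tangentSpaceAt hk hp₀.1,
      sub_mem_orthogonal_of_isNearestPoint hp₀, by linarith⟩).trans ?_
    refine J1_le_of_forall_infDist_le fun i hi => ?_
    rw [infDist_eq_norm_sub_starProjection]
    exact (hslab i (by simpa [roi] using hi)).le
  have hsample : ∀ y : RD D, (y = 0 ∨ ∃ j, y = b j) → ∃ z : RD D,
      ‖z - (p₀ + (ρ / 2) • y)‖ ≤ ρ / (8 * (d + 1)) ∧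
      ‖(z - p₀) - (tangentSpaceAt S p₀).starProjection (z - p₀)‖ ≤ 3 * σ ∧
      ‖(z - q) - H.starProjection (z - q)‖ ≤ 3 * σ / √κ := by
    intro y hy
    have hy1 : ‖y‖ ≤ 1 := by
      rcases hy with rfl | ⟨j, rfl⟩
      · simp
      · exact (b.norm_eq_one j).le
    have hsub : Metric.ball (p₀ + (ρ / 2) • y) (ρ / (8 * (d + 1))) ⊆ Metric.ball r ρ := by
      refine Metric.ball_subset_ball' ?_
      have h1 : dist (p₀ + (ρ / 2) • y) r ≤ ρ / 2 + σ := by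
        rw [dist_eq_norm, show p₀ + (ρ / 2) • y - r = (ρ / 2) • y - (r - p₀) by abel]
        refine (norm_sub_le _ _).trans ?_
        rw [norm_smul, Real.norm_of_nonneg (by positivity)]
        nlinarith
      have h2 : ρ / (8 * ((d : ℝ) + 1)) ≤ ρ / 8 := by
        apply div_le_div_of_nonneg_left hρ.le (by norm_num)
        linarith
      linarith
    obtain ⟨i, hi, hid⟩ := exists_infDist_le_of_J1_le (by positivity : 0 < 3 * σ) hκ hJ hsub
      (hshare y hy)
    rw [infDist_eq_norm_sub_starProjection] at hid
    refine ⟨x i, ?_, (hslab i (hsub hi)).le, hid⟩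
    rw [← dist_eq_norm]
    exact (Metric.mem_ball.1 hi).le
  obtain ⟨x₀, hx₀, hT₀, hH₀⟩ := hsample 0 (Or.inl rfl)
  rw [smul_zero, add_zero] at hx₀
  choose z hz hzT hzH using fun j => hsample (b j) (Or.inr ⟨j, rfl⟩)
  have hnear := norm_sub_starProjection_le_of_samples b hρ hx₀ hz hT₀ hzT hH₀ hzH
  set s := 2 * d * (4 * (3 * σ + 3 * σ / √κ) / ρ) with hs
  have hs_le : s ≤ 12 * d * (4 / √κ) / M := by
    have h1 : 3 * σ ≤ 3 * σ / √κ := by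
      rw [le_div_iff₀ hsκ]; nlinarith
    calc s ≤ 2 * d * (4 * (3 * σ / √κ + 3 * σ / √κ) / ρ) := by rw [hs]; gcongr
      _ = 12 * d * (4 / √κ) / M := by rw [hρM]; field_simp; ring
  have hs_half : s ≤ 1 / 2 := by
    refine hs_le.trans ?_
    rw [div_le_div_iff₀ hMpos two_pos, show 12 * (d : ℝ) * (4 / √κ) * 2 = 96 * d / √κ by ring,
      div_le_iff₀ hsκ]
    linarith
  have hs0 : 0 ≤ s := by positivity
  have hpq := norm_sub_le_three_mul hp₀.1 hr hout.1 hp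
  have hpp₀ : ‖p - p₀‖ ≤ 2 * (3 * σ) := by
    have e : p - p₀ = (p - q) + ((r - p₀) - (r - q)) := by abel
    have h1 := norm_add_le (p - q) ((r - p₀) - (r - q))
    rw [← e] at h1
    have h2 := norm_sub_le (r - p₀) (r - q)
    linarith [hout.1.2.2]
  have h3στ : 3 * σ ≤ τ / 40 := by rw [hτM]; nlinarith
  have hsqrt : √((2 * (24 * d * (4 / √κ) + 126)) ^ 2 / (τ / σ))
      = 2 * ((24 * d * (4 / √κ) + 126) / M) := by
    rw [Real.sqrt_div (by positivity), Real.sqrt_sq (by positivity)]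
    ring
  rw [hsqrt]
  refine maxPrincipalAngle_le_of_near (ε := (24 * d * (4 / √κ) + 126) / M) (by positivity) ?_ ?_
  · refine mul_le_mul_of_nonneg_right ?_ (by positivity)
    linarith [Real.pi_le_four]
  · intro u hu
    refine (norm_sub_starProjection_tangentSpaceAt_le_of_near hS hk hM hτ hQ hp₀.1 hp.1
      (by positivity : 0 < 3 * σ) h3στ hpp₀ hs0 hs_half hout.1.1 hnear hu).trans
      (mul_le_mul_of_nonneg_right ?_ (norm_nonneg _))
    have h4 : 21 * (3 * σ) / τ ≤ 63 / M := by
      rw [div_le_div_iff₀ hτ hMpos, hτM]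
      have : 0 ≤ σ * M * (M - 1) := mul_nonneg (mul_pos hσ hMpos).le (by linarith)
      linarith
    have h5 : (24 * d * (4 / √κ) + 126) / M
        = 2 * (12 * d * (4 / √κ) / M + 63 / M) := by ring
    linarith

theorem theorem3p2 (d D : ℕ) :
    ∃ C : ℝ, 0 < C ∧ ∃ M₀ : ℝ, 0 < M₀ ∧
      ∀ (k : ℕ) (_ : 1 ≤ k) (S : Set (RD D)) (_ : IsCompact S) (_ : IsSubmanifold k d S)
        (τ σ : ℝ) (_ : 0 < σ) (_ : reach S = ENNReal.ofReal τ) (_ : M₀ ≤ τ / σ)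
        (r : RD D) (_ : r ∈ Metric.thickening σ S),
        (∀ δ : ℝ, 0 < δ → ∃ N : ℕ, ∀ n : ℕ, N < n →
          ∃ E : Set (Fin n → RD D), MeasurableSet E ∧
            ENNReal.ofReal (1 - δ) ≤ Measure.pi (fun _ : Fin n => tubeUniform S σ) E ∧
            ∀ x ∈ E, ∀ (q : RD D) (H : Submodule ℝ (RD D)) (p : RD D),
              IsStep1Output d σ τ r x q H → IsNearestPoint S q p →
                maxPrincipalAngle H (tangentSpaceAt S p) ≤ √(C / (τ / σ))) ∧
        (∀ (n : ℕ) (x : Fin n → RD D) (q : RD D) (H : Submodule ℝ (RD D)) (p : RD D),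
          IsStep1Output d σ τ r x q H → IsNearestPoint S q p → ‖p - q‖ ≤ 3 * σ) := by
  -- half of the proportion of volume that a test ball captures
  set κ : ℝ := 1 / 2 * ((1 / (32 * (d + 1))) ^ d * (1 / 3) ^ D) with hκdef
  have hd0 : (0 : ℝ) ≤ d := by positivity
  have hκ : 0 < κ := by positivity
  have hκ1 : κ ≤ 1 := by
    have h1 : (1 / (32 * ((d : ℝ) + 1))) ^ d ≤ 1 :=
      pow_le_one₀ (by positivity) (by rw [div_le_one (by positivity)]; linarith)
    have h2 : ((1 : ℝ) / 3) ^ D ≤ 1 := pow_le_one₀ (by norm_num) (by norm_num)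
    have h3 : (1 / (32 * ((d : ℝ) + 1))) ^ d * (1 / 3) ^ D ≤ 1 :=
      mul_le_one₀ h1 (by positivity) h2
    linarith
  have hsκ : 0 < √κ := Real.sqrt_pos.2 hκ
  -- `M₀` keeps all scales `σ ≪ ρ ≪ τ` apart and makes the tangent space at `p₀` `1/2`-close to `H`
  refine ⟨(2 * (24 * d * (4 / √κ) + 126)) ^ 2, by positivity, (120 * (d + 1) / √κ) ^ 2,
    by positivity, ?_⟩
  intro k hk S hS hM τ σ hσ hreach hMτ r hr
  have hne : S.Nonempty := by
    obtain ⟨a, ha, -⟩ := Metric.mem_thickening_iff.1 hr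
    exact ⟨a, ha⟩
  have hbig : 120 * (d + 1) / √κ ≤ √(τ / σ) := Real.le_sqrt_of_sq_le hMτ
  have hτ : 0 < τ := by
    have h1 : 0 < τ / σ := lt_of_lt_of_le (by positivity) hMτ
    have h2 := mul_pos h1 hσ
    rwa [div_mul_cancel₀ _ hσ.ne'] at h2
  have hU : ∀ x, Metric.infDist x S < τ → ∃! p, IsNearestPoint S x p := fun x hx =>
    existsUnique_isNearestPoint_of_lt_reach hne hreach hx
  have hQ : ∀ x ∈ S, ∀ b ∈ S, ‖(b - x) - (tangentSpaceAt S x).starProjection (b - x)‖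
      ≤ ‖b - x‖ ^ 2 / (2 * τ) := fun x hx b hb =>
    norm_sub_starProjection_tangentSpaceAt_le hS hk hM hτ hU hx hb
  obtain ⟨p₀, hp₀⟩ := exists_isNearestPoint hS hne r
  have hrp₀ := norm_sub_lt_of_isNearestPoint_of_mem_thickening hp₀ hr
  refine ⟨fun δ hδ => ?_, fun n x q H p hout hp => norm_sub_le_three_mul hp₀.1 hrp₀ hout.1 hp⟩
  have hprob := isProbabilityMeasure_tubeUniform hS hne hσ
  have hfr := hM.finrank_tangentSpaceAt hk hp₀.1
  let b : OrthonormalBasis (Fin d) ℝ (tangentSpaceAt S p₀) :=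
    (stdOrthonormalBasis ℝ (tangentSpaceAt S p₀)).reindex (finCongr hfr)
  set ρ := √(σ * τ) with hρdef
  have hρ : 0 < ρ := Real.sqrt_pos.2 (by positivity)
  have hρ2 : ρ ^ 2 = σ * τ := Real.sq_sqrt (by positivity)
  have hM120 : 120 * ((d : ℝ) + 1) ≤ √(τ / σ) := by
    refine le_trans ?_ hbig
    rw [le_div_iff₀ hsκ]
    have : √κ ≤ 1 := Real.sqrt_le_one.2 hκ1
    nlinarith
  have hρM : ρ = σ * √(τ / σ) := by
    rw [← Real.sqrt_sq hσ.le, ← Real.sqrt_mul (sq_nonneg σ), Real.sqrt_sq hσ.le, hρdef]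
    congr 1
    field_simp
  have hσρ : 120 * ((d : ℝ) + 1) * σ ≤ ρ := by rw [hρM]; nlinarith
  have hρτ : 3 * ρ ≤ τ / 40 := by nlinarith
  -- the test balls: one at the foot point of `r`, and one in each basis direction
  let c : Option (Fin d) → RD D := fun o => o.elim 0 fun j => (b j : RD D)
  have hcT : ∀ o, c o ∈ tangentSpaceAt S p₀ ∧ ‖c o‖ ≤ 1 := by
    rintro (_ | j)
    · exact ⟨Submodule.zero_mem _, by simp [c]⟩
    · exact ⟨(b j).2, (b.norm_eq_one j).le⟩
  let Q : Option (Fin d) → Set (RD D) := fun o =>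
    Metric.ball (p₀ + (ρ / 2) • c o) (ρ / (8 * (d + 1)))
  let f : Option (Fin d) → RD D → ℝ := fun o x => (Q o).indicator (fun _ => (1 : ℝ)) x
      - κ * (Metric.ball r ρ).indicator (fun _ => (1 : ℝ)) x
  have hf : ∀ o, Measurable (f o) := fun o =>
    (measurable_const.indicator Metric.isOpen_ball.measurableSet).sub
      ((measurable_const.indicator Metric.isOpen_ball.measurableSet).const_mul κ)
  have hfB : ∀ o x, |f o x| ≤ 2 := by
    intro o x
    have h1 : ∀ A : Set (RD D), 0 ≤ A.indicator (fun _ => (1 : ℝ)) x ∧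
        A.indicator (fun _ => (1 : ℝ)) x ≤ 1 := fun A =>
      ⟨Set.indicator_nonneg (fun _ _ => zero_le_one) _,
        Set.indicator_le_self' (fun _ _ => zero_le_one) _⟩
    obtain ⟨a1, a2⟩ := h1 (Q o)
    obtain ⟨a3, a4⟩ := h1 (Metric.ball r ρ)
    simp only [f]
    rw [abs_le]
    constructor <;> nlinarith
  have hfpos : ∀ o, 0 < ∫ x, f o x ∂(tubeUniform S σ) := by
    intro o
    refine integral_indicator_sub_pos hS hσ hρ hκ hr Metric.isOpen_ball.measurableSet ?_
    have h1 := ofReal_mul_volume_roi_le hσ hτ hρ (by linarith : (1 : ℝ) ≤ d + 1) hρ2 hσρ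
      (hQ p₀ hp₀.1) (fun t ht htρ => exists_mem_starProjection_eq hS hk hM hτ hQ hp₀.1
        (by positivity) hρτ ht (by linarith)) hrp₀ (hcT o).1 (hcT o).2
    rw [hfr] at h1
    have e : 2 * κ = (1 / (32 * ((d : ℝ) + 1))) ^ d * (1 / 3) ^ D := by rw [hκdef]; ring
    rwa [e]
  obtain ⟨N, hN⟩ := exists_forall_exists_measurableSet_pi (tubeUniform S σ)
    Metric.isOpen_thickening.measurableSet (tubeUniform_self hS hne hσ) hf hfB hfpos hδ
  refine ⟨N, fun n hn => ?_⟩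
  obtain ⟨E, hE, hPE, hEx⟩ := hN n hn
  refine ⟨E, hE, hPE, fun x hx q H p hout hp => ?_⟩
  obtain ⟨hx1, hx2⟩ := hEx x hx
  refine maxPrincipalAngle_le_of_samples hS hk hM hσ hτ hQ hκ hκ1 hbig hrp₀ hp₀ b hx1 ?_ hout hp
  rintro y (rfl | ⟨j, rfl⟩)
  · exact hx2 none
  · exact hx2 (some j)
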